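/- Bit strings are written with the least significant bit first; $\varepsilon$ is the empty bit string; $\mathrm{bton}(w)$ is the natural number represented by $w$ (so $\mathrm{bton}(\varepsilon)=0$), and $\mathrm{ntob}(m)$ is the shortest non-empty bit string that represents $m$. A RAM memory state is a function $\sigma:\mathbb{N}\to\{0,1\}^*$ with $\sigma(i)=\varepsilon$ for all but finitely many registers $i$. A source operand $s$ is of the form $\#i$, $i$ or $@i$ ($i\in\mathbb{N}$), with value $\mathrm{ntob}(i)$, $\sigma(i)$ or $\sigma(\mathrm{bton}(\sigma(i)))$, respectively, in state $\sigma$; a destination operand $d$ is of the form $i$ or $@i$ and denotes the register with number $i$ or $\mathrm{bton}(\sigma(i))$, respectively. The SRRAM instructions are the following: - $o{:}s_1{:}s_2{:}d$, which puts the result of the operation $o$ on the values of $s_1,s_2$ into the register denoted by $d$, where $o$ is addition, proper subtraction, multiplication or division (with $x\div 0=0$) of the numbers represented, the result being given by $\mathrm{ntob}$, or bitwise and, or, exclusive or (the shorter operand being padded with zeros at the most significant end); - $o{:}s_1{:}d$, likewise, where $o$ is bitwise negation, one of the shifts $\varepsilon\mapsto\varepsilon,\ bw\mapsto 0bw$ (left)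 and $\varepsilon\mapsto\varepsilon,\ bw\mapsto w$ (right), one of the rotations $\varepsilon\mapsto\varepsilon,\ wb\mapsto bw$ (left) and $\varepsilon\mapsto\varepsilon,\ bw\mapsto wb$ (right), or the identity; - the comparisons $o{:}s_1{:}s_2$, which leave the state unchanged and produce the reply $1$ if the number represented by the value of $s_1$ is equal to ($o=\mathrm{eq}$), respectively greater than ($o=\mathrm{gt}$), the one represented by the value of $s_2$, and the reply $0$ otherwise. An SRRAM program is a term $(t_1;\ldots;t_m)^\omega$, $m\ge 1$, denoting the infinite repetition of the instruction sequence $t_1;\ldots;t_m$, where each $t_i$ is a non-comparison instruction $a$, a positive test followed by a jump $+a;\#l$ with $a$ a comparison and $l\in\mathbb{N}$, a forward jump $\#l$ with $l\in\mathbb{N}$, or the termination instruction $!$. The thread $|P|$ extracted from $P$ is the behaviour of $P$ under execution: instructions are performed one after another, except that after $+a$ the next instruction is skipped if the reply of $a$ is $0$, that $\#l$ proceeds with the $l$th next instruction, that $!$ terminates, and that there is inaction after $\#0$, in case of an infinite chain of jumps, and when there is no instruction to proceed with. For a thread $x$ and a state $\sigma$, applying $x$ to the RAM memory with state $\sigma$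 yields the RAM memory in the state reached if the interaction terminates after finitely many actions, and the inoperative RAM memory otherwise; using that memory turns $x$ into a thread in which each action carried out on the memory is replaced by an internal action, and the depth of a thread is the maximal number of actions (internal ones included) it can perform. Let $n\in\mathbb{N}$ and let $F:(\{0,1\}^*)^n\rightharpoonup\{0,1\}^*$ be a partial function. $P$ computes $F$ if there is a $T:\mathbb{N}\to\mathbb{N}$ such that, for all $w_1,\ldots,w_n\in\{0,1\}^*$ and with $\sigma_w$ the state that has $w_k$ in register $k$ for $1\le k\le n$ and $\varepsilon$ in all other registers: if $F(w_1,\ldots,w_n)$ is defined, then applying $|P|$ to the memory with state $\sigma_w$ yields an operative memory with $F(w_1,\ldots,w_n)$ in register $0$, and the use of that memory by $|P|$ results in a thread of depth at most $T(|w_1|+\cdots+|w_n|)$, where $|w_k|$ is the length of $w_k$; if $F(w_1,\ldots,w_n)$ is undefined, then applying $|P|$ to the memory with state $\sigma_w$ yields the inoperative memory. **Theorem.** For each $n\in\mathbb{N}$ and each partial function $F:(\{0,1\}^*)^n\rightharpoonup\{0,1\}^*$, there exists an SRRAM program $P$ that computes $F$ if and only if $F$ is Turing-computable, i.e. there is a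 deterministic single-tape Turing machine (with finitely many states and tape symbols) that, started at the first symbol of the input $w_1\#\cdots w_n\#$, halts if and only if $F(w_1,\ldots,w_n)$ is defined, and in that case halts with $F(w_1,\ldots,w_n)$ as the longest block of bits from the head position to the right. -/

import Mathlib

/-! ## Program algebra: primitive instructions and closed terms -/

namespace PGA

/-- Primitive instructions over a set `A` of basic instructions. -/
inductive PInstr (A : Type) where
  /-- plain basic instruction `a` -/
  | plain (a : A)
  /-- positive test instruction `+a` -/
  | pos (a : A)
  /-- negative test instruction `-a` -/
  | neg (a : A)
  /-- forward jump instruction `#l` -/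
  | jmp (l : ℕ)
  /-- termination instruction `!` -/
  | halt

/-- Closed terms of the sort of instruction sequences. -/
inductive Term (A : Type) where
  | instr (u : PInstr A)
  /-- concatenation `s ; t` -/
  | conc (s t : Term A)
  /-- repetition `t^ω` -/
  | rep (t : Term A)

variable {A : Type}

/-- The length of the instruction sequence represented by a closed term. -/
noncomputable def Term.len : Term A → ℕ∞
  | .instr _ => 1
  | .conc s t => s.len + t.len
  | .rep _ => ⊤

open Classical in
/-- The instruction at position `i` (counted from `0`) of the instruction sequence represented by
a closed term; `none` beyond its end. In the case of a repetition of an infinite sequence the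
modulus is `(⊤ : ℕ∞).toNat = 0`, and `i % 0 = i`, in accordance with `(t^ω)^ω = t^ω`. -/
noncomputable def Term.get : Term A → ℕ → Option (PInstr A)
  | .instr u, i => if i = 0 then some u else none
  | .conc s t, i => if (i : ℕ∞) < s.len then s.get i else t.get (i - s.len.toNat)
  | .rep t, i => t.get (i % t.len.toNat)

/-! ## Threads -/

/-- The possible roots of a thread: termination `S`, inaction `D`, the internal action `τ`,
or a basic action. -/
inductive Node (A : Type) where
  | term
  | dead
  | tau
  | act (a : A)

/-- The ways in which a thread may proceed after its root. A basic action proceeds according to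
the Boolean reply; because of `x ⊴ τ ⊵ y = τ ∘ x` there is one way to proceed after `τ`. -/
def Node.Reply : Node A → Type
  | .term => Empty
  | .dead => Empty
  | .tau => Unit
  | .act _ => Bool

/-- The polynomial functor `X ↦ {S} + {D} + X + A × (Bool → X)`. -/
def threadF (A : Type) : PFunctor.{0, 0} := ⟨Node A, Node.Reply⟩

/-- Finite and infinite threads: the final coalgebra of `threadF A`. Threads whose approximations
up to every finite depth coincide are equal in it. -/
abbrev Thread (A : Type) : Type := (threadF A).M

/-- One layer of a thread with successors in `X`. -/
abbrev Layer (A X : Type) : Type := (threadF A) X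

/-- `S` as a layer -/
def Layer.term {X : Type} : Layer A X := ⟨Node.term, fun e : Empty => e.elim⟩
/-- `D` as a layer -/
def Layer.dead {X : Type} : Layer A X := ⟨Node.dead, fun e : Empty => e.elim⟩
/-- `τ ∘ x` as a layer -/
def Layer.tau {X : Type} (x : X) : Layer A X := ⟨Node.tau, fun _ : Unit => x⟩
/-- Basic action `a`, proceeding with `f b` on reply `b`, as a layer. -/
def Layer.act {X : Type} (a : A) (f : Bool → X) : Layer A X := ⟨Node.act a, f⟩

/-- the termination constant `S` -/
def Thread.term : Thread A := PFunctor.M.mk Layer.term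
/-- the inaction constant `D` -/
def Thread.dead : Thread A := PFunctor.M.mk Layer.dead
/-- `τ ∘ x` -/
def Thread.tau (x : Thread A) : Thread A := PFunctor.M.mk (Layer.tau x)
/-- The postconditional composition that performs `a` and proceeds as `f true` on reply `1` and as
`f false` on reply `0`. -/
def Thread.act (a : A) (f : Bool → Thread A) : Thread A := PFunctor.M.mk (Layer.act a f)

/-- Number of actions that a thread can perform, cut off at `n`: the depth of the approximation
of the thread up to depth `n`. -/
def Thread.depthUpTo : ℕ → Thread A → ℕ
  | 0, _ => 0
  | n + 1, x =>
    match PFunctor.M.dest x with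
    | ⟨.term, _⟩ => 0
    | ⟨.dead, _⟩ => 0
    | ⟨.tau, f⟩ => depthUpTo n (f ()) + 1
    | ⟨.act _, f⟩ => max (depthUpTo n (f true)) (depthUpTo n (f false)) + 1

/-- The depth of a thread, `⊤` if there is no finite upper bound to the number of actions that it
can perform. -/
noncomputable def Thread.depth (x : Thread A) : ℕ∞ := ⨆ n : ℕ, (x.depthUpTo n : ℕ∞)

/-! ## Thread extraction -/

/-- One forward jump within the instruction sequence represented by `t`, from position `i`;
`none` if the instruction at `i` is not a jump over a positive distance. -/
noncomputable def Term.jumpStep (t : Term A) (i : ℕ) : Option ℕ :=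
  match t.get i with
  | some (.jmp (l + 1)) => some (i + (l + 1))
  | _ => none

/-- The first layer of the behaviour produced when execution starts at a position `j` that is not
occupied by a jump over a positive distance. There is inaction if `j` is beyond the end of the
sequence or occupied by the jump `#0`. -/
noncomputable def Term.layerAt (t : Term A) (j : ℕ) : Layer A ℕ :=
  match t.get j with
  | some (.plain a) => Layer.act a fun _ => j + 1
  | some (.pos a) => Layer.act a fun b => if b then j + 1 else j + 2
  | some (.neg a) => Layer.act a fun b => if b then j + 2 else j + 1
  | some .halt => Layer.term
  | some (.jmp _) => Layer.dead
  | none => Layer.dead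

open Classical in
/-- The first layer of the behaviour produced when execution starts at position `i`: the chain of
forward jumps that starts at `i` is followed to its end; there is inaction if it is infinite. -/
noncomputable def Term.behave (t : Term A) (i : ℕ) : Layer A ℕ :=
  if h : (StateTransition.eval t.jumpStep i).Dom then
    t.layerAt ((StateTransition.eval t.jumpStep i).get h)
  else Layer.dead

/-- Thread extraction `|t|`. -/
noncomputable def Term.extract (t : Term A) : Thread A := PFunctor.M.corec t.behave 0

end PGA

/-! ## RAM memories and their interaction with threads -/

namespace RAM

/-- RAM memory states. A bit string is a list of Booleans, least significant bit first. -/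
def MState : Type := {σ : ℕ → List Bool // ∃ i, ∀ j, σ (i + j) = []}

/-- `σ[i ↦ w]` -/
def MState.set (σ : MState) (i : ℕ) (w : List Bool) : MState :=
  ⟨Function.update σ.1 i w, by
    obtain ⟨k, hk⟩ := σ.2
    refine ⟨k + (i + 1), fun j => ?_⟩
    rw [Function.update_of_ne (by omega), add_assoc]
    exact hk _⟩

/-- The memory state that has `w_k` in register `k` for `1 ≤ k ≤ n` and the empty bit string in all
other registers (`w k` is the `(k+1)`-st of the `n` bit strings). -/
def MState.input {n : ℕ} (w : Fin n → List Bool) : MState :=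
  ⟨fun i => if h : 1 ≤ i ∧ i ≤ n then w ⟨i - 1, by omega⟩ else [],
    n + 1, fun j => dif_neg (by omega)⟩

/-- A basic instruction `p/q` for a RAM memory: on execution in state `σ` the reply is `p σ` and
the new state is `q σ`. No locality condition on `p` and `q` is imposed, since the comparison of the
contents of two registers is to be among the basic instructions; which basic instructions may occur
in a program is restricted in `IsUnit` below. -/
structure BInstr where
  p : MState → Bool
  q : MState → MState

/-- RAM memories: an operative one in a given state, or the inoperative one. -/
inductive Memory where
  | op (σ : MState)
  | inop

open PGA

/-- `Terminates x σ σ'`: starting in memory state `σ`, the thread `x` reaches termination with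
memory state `σ'` after finitely many actions. -/
inductive Terminates : Thread BInstr → MState → MState → Prop
  | term (σ : MState) : Terminates Thread.term σ σ
  | tau (x : Thread BInstr) (σ σ' : MState) :
      Terminates x σ σ' → Terminates (Thread.tau x) σ σ'
  | act (a : BInstr) (f : Bool → Thread BInstr) (σ σ' : MState) :
      Terminates (f (a.p σ)) (a.q σ) σ' → Terminates (Thread.act a f) σ σ'

open Classical in
/-- The apply operator `x • u`: the memory that results from the interaction of the thread `x` with
the memory `u`; it is inoperative if the interaction does not end in termination. -/
noncomputable def apply (x : Thread BInstr) : Memory → Memory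
  | .op σ => if h : ∃ σ', Terminates x σ σ' then .op h.choose else .inop
  | .inop => .inop

/-- The first layer of the thread that results from the use of a memory by a thread. -/
def useLayer : Thread BInstr × Memory → Layer BInstr (Thread BInstr × Memory)
  | (x, u) =>
    match PFunctor.M.dest x with
    | ⟨.term, _⟩ => Layer.term
    | ⟨.dead, _⟩ => Layer.dead
    | ⟨.tau, f⟩ => Layer.tau (f (), u)
    | ⟨.act a, f⟩ =>
      match u with
      | .op σ => Layer.tau (f (a.p σ), .op (a.q σ))
      | .inop => Layer.tau (Thread.dead, .inop)

/-- The use operator `x / u`: the thread that results from the interaction of the thread `x` with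
the memory `u`; each action carried out on the memory leaves an internal action as a trace. -/
def use (x : Thread BInstr) (u : Memory) : Thread BInstr := PFunctor.M.corec useLayer (x, u)

/-- `t` computes the partial function `F` in time `T` under the uniform time measure. -/
def ComputesInTime {n : ℕ} (t : Term BInstr) (F : (Fin n → List Bool) →. List Bool)
    (T : ℕ → ℕ) : Prop :=
  (∀ w, ∀ v ∈ F w,
    (∃ σ : MState, apply t.extract (.op (MState.input w)) = .op (σ.set 0 v)) ∧
    (use t.extract (.op (MState.input w))).depth ≤ (T (∑ k, (w k).length) : ℕ∞)) ∧
  (∀ w, ¬ (F w).Dom → apply t.extract (.op (MState.input w)) = .inop)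

/-- `t` computes the partial function `F`. -/
def Computes {n : ℕ} (t : Term BInstr) (F : (Fin n → List Bool) →. List Bool) : Prop :=
  ∃ T : ℕ → ℕ, ComputesInTime t F T

/-! ## Operations on bit strings -/

/-- The natural to bit string function. -/
def ntob (n : ℕ) : List Bool :=
  if n ≤ 1 then [decide (n = 1)] else decide (n % 2 = 1) :: ntob (n / 2)
termination_by n
decreasing_by omega

/-- The bit string to natural function. -/
def bton : List Bool → ℕ
  | [] => 0
  | b :: w => 2 * bton w + b.toNat

/-- Bitwise application of `f`, the shorter operand being extended with zeros at the most
significant end. -/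
def bitwise (f : Bool → Bool → Bool) : List Bool → List Bool → List Bool
  | [], [] => []
  | [], b :: w => f false b :: bitwise f [] w
  | b :: w, [] => f b false :: bitwise f w []
  | b₁ :: w₁, b₂ :: w₂ => f b₁ b₂ :: bitwise f w₁ w₂

/-- shift left -/
def shl : List Bool → List Bool
  | [] => []
  | b :: w => false :: b :: w

/-- shift right -/
def shr : List Bool → List Bool
  | [] => []
  | _ :: w => w

/-- rotate left: `w b ↦ b w` -/
def rol : List Bool → List Bool
  | [] => []
  | b :: w => (b :: w).getLast (List.cons_ne_nil b w) :: (b :: w).dropLast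

/-- rotate right: `b w ↦ w b` -/
def ror : List Bool → List Bool
  | [] => []
  | b :: w => w ++ [b]

/-! ## The instructions of semi-realistic RAMs -/

inductive BinOp where
  | add | sub | mul | div | and | or | xor

inductive UnOp where
  | not | shl | shr | rol | ror | mov

inductive CmpOp where
  | eq | gt

/-- Source operands: immediate `#i`, direct `i`, indirect `@i`. -/
inductive Src where
  | imm (i : ℕ)
  | dir (i : ℕ)
  | ind (i : ℕ)

/-- Destination operands: direct `i`, indirect `@i`. -/
inductive Dst where
  | dir (i : ℕ)
  | ind (i : ℕ)

/-- Subtraction is proper subtraction and division by zero yields zero, as on `ℕ` here. -/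
def BinOp.eval : BinOp → List Bool → List Bool → List Bool
  | .add, w₁, w₂ => ntob (bton w₁ + bton w₂)
  | .sub, w₁, w₂ => ntob (bton w₁ - bton w₂)
  | .mul, w₁, w₂ => ntob (bton w₁ * bton w₂)
  | .div, w₁, w₂ => ntob (bton w₁ / bton w₂)
  | .and, w₁, w₂ => bitwise Bool.and w₁ w₂
  | .or, w₁, w₂ => bitwise Bool.or w₁ w₂
  | .xor, w₁, w₂ => bitwise Bool.xor w₁ w₂

def UnOp.eval : UnOp → List Bool → List Bool
  | .not, w => w.map Bool.not
  | .shl, w => RAM.shl w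
  | .shr, w => RAM.shr w
  | .rol, w => RAM.rol w
  | .ror, w => RAM.ror w
  | .mov, w => w

def CmpOp.eval : CmpOp → List Bool → List Bool → Bool
  | .eq, w₁, w₂ => decide (bton w₁ = bton w₂)
  | .gt, w₁, w₂ => decide (bton w₁ > bton w₂)

/-- The value of a source operand in a memory state. -/
def Src.val (σ : MState) : Src → List Bool
  | .imm i => ntob i
  | .dir i => σ.1 i
  | .ind i => σ.1 (bton (σ.1 i))

/-- The number of the register given by a destination operand in a memory state. -/
def Dst.reg (σ : MState) : Dst → ℕ
  | .dir i => i
  | .ind i => bton (σ.1 i)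

/-- The instruction `binop:s₁:s₂:d`. -/
def binInstr (o : BinOp) (s₁ s₂ : Src) (d : Dst) : BInstr :=
  ⟨fun _ => true, fun σ => σ.set (d.reg σ) (o.eval (s₁.val σ) (s₂.val σ))⟩

/-- The instruction `unop:s₁:d`. -/
def unInstr (o : UnOp) (s₁ : Src) (d : Dst) : BInstr :=
  ⟨fun _ => true, fun σ => σ.set (d.reg σ) (o.eval (s₁.val σ))⟩

/-- The instruction `cmpop:s₁:s₂`. -/
def cmpInstr (o : CmpOp) (s₁ s₂ : Src) : BInstr :=
  ⟨fun σ => o.eval (s₁.val σ) (s₂.val σ), fun σ => σ⟩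

/-- The terms from which the bodies of semi-realistic RAM programs are put together. -/
inductive IsUnit : Term BInstr → Prop
  | bin (o : BinOp) (s₁ s₂ : Src) (d : Dst) : IsUnit (.instr (.plain (binInstr o s₁ s₂ d)))
  | un (o : UnOp) (s₁ : Src) (d : Dst) : IsUnit (.instr (.plain (unInstr o s₁ d)))
  | cmp (o : CmpOp) (s₁ s₂ : Src) (l : ℕ) :
      IsUnit (.conc (.instr (.pos (cmpInstr o s₁ s₂))) (.instr (.jmp l)))
  | jmp (l : ℕ) : IsUnit (.instr (.jmp l))
  | halt : IsUnit (.instr .halt)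

/-- Concatenations `t₁ ; … ; tₘ` (with `m ≥ 1`) of such terms. -/
inductive IsBody : Term BInstr → Prop
  | single (t : Term BInstr) : IsUnit t → IsBody t
  | cons (t s : Term BInstr) : IsUnit t → IsBody s → IsBody (.conc t s)

/-- Semi-realistic RAM programs: the terms `(t₁ ; … ; tₘ)^ω`. -/
def IsSRRAMProgram (t : Term BInstr) : Prop :=
  ∃ s : Term BInstr, IsBody s ∧ t = .rep s

end RAM

/-! ## Turing-computability -/

/-- The word `w₁ # w₂ # … wₙ #` on a tape on which `bit b` stands for the bit `b`. -/
def TuringInput {Γ : Type} (bit : Bool → Γ) (sep : Γ) {n : ℕ} (w : Fin n → List Bool) : List Γ :=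
  (List.ofFn w).flatMap fun v => v.map bit ++ [sep]

/-- The longest block of bits at the beginning of the half-tape `L` is the bit string `v`. -/
def TuringOutput {Γ : Type} [Inhabited Γ] (bit : Bool → Γ) (L : Turing.ListBlank Γ)
    (v : List Bool) : Prop :=
  (∀ i : Fin v.length, L.nth i = bit (v.get i)) ∧ ∀ b, L.nth v.length ≠ bit b

/-- A partial function on tuples of bit strings is Turing-computable if it is computed by a
deterministic single-tape Turing machine with a finite tape alphabet and finitely many states. The
machine starts at the first symbol of the input `w₁ # … wₙ #`, where `0`, `1`, `#` and the blank are
four different symbols; it halts iff the function is defined, and then the value of the function is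
the longest block of bits from the head position to the right. -/
def TuringComputable {n : ℕ} (F : (Fin n → List Bool) →. List Bool) : Prop :=
  ∃ (Γ Λ : Type) (_ : Inhabited Γ) (_ : Finite Γ) (_ : Inhabited Λ) (_ : Finite Λ)
    (M : Turing.TM0.Machine Γ Λ) (bit : Bool → Γ) (sep : Γ),
    Function.Injective bit ∧ (∀ b, bit b ≠ sep) ∧ (∀ b, bit b ≠ default) ∧ sep ≠ default ∧
    (∀ w, ∀ v ∈ F w,
      ∃ L ∈ Turing.TM0.eval M (TuringInput bit sep w), TuringOutput bit L v) ∧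
    (∀ w, ¬ (F w).Dom → ¬ (Turing.TM0.eval M (TuringInput bit sep w)).Dom)

/-!
A program and a Turing machine are both deterministic transition systems, and the theorem says that
either kind can compute what the other can.

*Programs.* The thread extracted from a program, applied to a memory, behaves like the transition
system `RAM.step` on pairs of an instruction position and a memory state: it terminates exactly if
that system halts. Inaction and the inoperative memory correspond to infinite runs, since the jump
`#0` does not change the position and an infinite chain of jumps is an infinite run. The time bound
in the definition of computability is no restriction: there are only finitely many inputs of a given
total length, so the maximum of the finite depths bounds them all. This reduces computability by
programs to evaluation of `RAM.step` (`RAM.computes_iff`).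

*From programs to Turing machines.* With memory states represented by finite lists of words, each
instruction is a primitive recursive operation, so a computable function is partial recursive
(`RAM.partrec_of_computes`). A partial recursive function is evaluated, on numbers that code the
input and the output, by the stack machine `Turing.PartrecToTM2.tr` of Mathlib. The codes are chosen
such that their binary digits are obtained symbol by symbol from the input word `w₁ # … wₙ #`, and
that the output word is obtained from them by removing the most significant digit; two loops added
to the stack machine do this (`Turing.StackIO.machine`). Mathlib's translation of stack machines
yields a Turing machine in which the first cell of the tape carries an extra mark; one step before
and one step after the simulation set this mark and skip its cell (`Turing.TM0.frame`), which gives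
`Turing.StackIO.turingComputable_of_partrec`.

*From Turing machines to programs.* A program `(t₁ ; … ; tₘ)^ω` can run loops, because a forward jump
of nearly `m` positions leads backward modulo the repetition (`RAM.exists_program`). The two halves
of the tape are kept as numbers in two registers, with the tape symbols as digits and the symbol
nearest to the head as the least significant one. Moving the head is division by the
base on one side and multiplication on the other, and the finite transition table is a list of
guarded assignments (`RAM.machineStep_spec`). Since numbers do not determine the length of a bit
string, words need care on input and output. On input, the sum of a word and its bitwise
negation is `2 ^ l - 1`, where `l` is the length of the word, and this counts the iterations of the
loop that reads it. On output, a bit `1` is added at the most significant end, so that the shortest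
representation keeps the zeros below it, and is removed by a rotation and a shift
(`RAM.run_output`).
-/

/-! ### Transition systems -/

namespace StateTransition

theorem Reaches.head {σ : Type*} {f : σ → Option σ} {a b c : σ} (hab : f a = some b)
    (hbc : Reaches f b c) : Reaches f a c :=
  Relation.ReflTransGen.head hab hbc

/-- A state lying in a set in which progress is always possible starts an infinite run. -/
theorem not_dom_of_progress {σ : Type*} {f : σ → Option σ} {S : σ → Prop}
    (h : ∀ a, S a → ∃ b, S b ∧ Reaches₁ f a b) {a : σ} (ha : S a) : ¬ (eval f a).Dom := by
  intro hd
  obtain ⟨hr, hn⟩ := mem_eval.1 (Part.get_mem hd)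
  -- the states from which `S` is reachable are closed under `f`, and `f` is defined on them
  have key : ∀ c, Reaches f a c → ∃ b, S b ∧ Reaches₁ f c b := by
    intro c hc
    induction hc with
    | refl => exact h a ha
    | tail _ hcd ih =>
      obtain ⟨b, hb, hcb⟩ := ih
      obtain ⟨b', hb', hbb'⟩ := h b hb
      have := reaches₁_fwd hcb hcd
      exact ⟨b', hb', Relation.TransGen.trans_right this hbb'⟩
  obtain ⟨b, -, hb⟩ := key _ hr
  obtain ⟨b', h', -⟩ := Relation.TransGen.head'_iff.1 hb
  rw [Option.mem_def, hn] at h'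
  cases h'

/-- Every step of `f₁` is matched by at least one step of `f₂`, with no condition on halting. -/
def Simulates {σ₁ σ₂ : Type*} (f₁ : σ₁ → Option σ₁) (f₂ : σ₂ → Option σ₂) (tr : σ₁ → σ₂ → Prop) :
    Prop :=
  ∀ a₁ b₁ a₂, tr a₁ a₂ → f₁ a₁ = some b₁ → ∃ b₂, tr b₁ b₂ ∧ Reaches₁ f₂ a₂ b₂

namespace Simulates

variable {σ₁ σ₂ : Type*} {f₁ : σ₁ → Option σ₁} {f₂ : σ₂ → Option σ₂} {tr : σ₁ → σ₂ → Prop}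

theorem reaches (H : Simulates f₁ f₂ tr) {a₁ b₁ : σ₁} {a₂ : σ₂} (haa : tr a₁ a₂)
    (h : Reaches f₁ a₁ b₁) : ∃ b₂, tr b₁ b₂ ∧ Reaches f₂ a₂ b₂ := by
  induction h with
  | refl => exact ⟨a₂, haa, .refl⟩
  | tail _ hbc ih =>
    obtain ⟨b₂, hb, hab⟩ := ih
    obtain ⟨c₂, hc, hbc'⟩ := H _ _ _ hb hbc
    exact ⟨c₂, hc, hab.trans hbc'.to_reflTransGen⟩

theorem not_dom (H : Simulates f₁ f₂ tr) {a₁ : σ₁} {a₂ : σ₂} (haa : tr a₁ a₂)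
    (h : ¬ (eval f₁ a₁).Dom) : ¬ (eval f₂ a₂).Dom := by
  refine not_dom_of_progress (S := fun a₂ => ∃ a₁, tr a₁ a₂ ∧ ¬ (eval f₁ a₁).Dom) ?_ ⟨a₁, haa, h⟩
  rintro c₂ ⟨c₁, hc, hn⟩
  rcases e : f₁ c₁ with _ | d₁
  · exact (hn (Part.dom_iff_mem.2 ⟨c₁, mem_eval.2 ⟨.refl, e⟩⟩)).elim
  · obtain ⟨d₂, hd, hcd⟩ := H _ _ _ hc e
    exact ⟨d₂, ⟨d₁, hd, by rwa [← reaches_eval (.single e)]⟩, hcd⟩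

end Simulates

end StateTransition

/-! ### Thread extraction as a transition system -/

namespace PGA

variable {A : Type}

/-- The thread extracted from the instruction sequence of `t` when execution starts at
position `i`. -/
noncomputable def Term.threadAt (t : Term A) (i : ℕ) : Thread A := PFunctor.M.corec t.behave i

theorem Term.threadAt_eq (t : Term A) (i : ℕ) :
    t.threadAt i = PFunctor.M.mk ((threadF A).map t.threadAt (t.behave i)) :=
  PFunctor.M.corec_def _ _

theorem Term.behave_of_reaches {t : Term A} {i j : ℕ}
    (h : StateTransition.Reaches t.jumpStep i j) : t.behave i = t.behave j := by
  unfold Term.behave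
  rw [StateTransition.reaches_eval h]

theorem Term.threadAt_of_reaches {t : Term A} {i j : ℕ}
    (h : StateTransition.Reaches t.jumpStep i j) : t.threadAt i = t.threadAt j := by
  rw [threadAt_eq, threadAt_eq, behave_of_reaches h]

theorem Term.behave_of_jumpStep_eq_none {t : Term A} {i : ℕ} (h : t.jumpStep i = none) :
    t.behave i = t.layerAt i := by
  have hm : i ∈ StateTransition.eval t.jumpStep i :=
    StateTransition.mem_eval.2 ⟨.refl, h⟩
  have hd : (StateTransition.eval t.jumpStep i).Dom := Part.dom_iff_mem.2 ⟨_, hm⟩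
  rw [Term.behave, dif_pos hd, Part.get_eq_of_mem hm]

theorem Term.threadAt_of_jumpStep_eq_none {t : Term A} {i : ℕ} (h : t.jumpStep i = none) :
    t.threadAt i = PFunctor.M.mk ((threadF A).map t.threadAt (t.layerAt i)) := by
  rw [threadAt_eq, behave_of_jumpStep_eq_none h]

theorem map_dead {X Y : Type} (f : X → Y) :
    (threadF A).map f (Layer.dead : Layer A X) = (Layer.dead : Layer A Y) := by
  unfold Layer.dead
  exact congrArg (Sigma.mk _) (funext fun e : Empty => e.elim)

theorem map_term {X Y : Type} (f : X → Y) :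
    (threadF A).map f (Layer.term : Layer A X) = (Layer.term : Layer A Y) := by
  unfold Layer.term
  exact congrArg (Sigma.mk _) (funext fun e : Empty => e.elim)

theorem Term.threadAt_plain {t : Term A} {i : ℕ} {a : A} (h : t.get i = some (.plain a)) :
    t.threadAt i = Thread.act a fun _ => t.threadAt (i + 1) := by
  rw [threadAt_of_jumpStep_eq_none (by simp [jumpStep, h]), layerAt, h]
  rfl

theorem Term.threadAt_pos {t : Term A} {i : ℕ} {a : A} (h : t.get i = some (.pos a)) :
    t.threadAt i = Thread.act a fun b => t.threadAt (if b then i + 1 else i + 2) := by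
  rw [threadAt_of_jumpStep_eq_none (by simp [jumpStep, h]), layerAt, h]
  rfl

theorem Term.threadAt_neg {t : Term A} {i : ℕ} {a : A} (h : t.get i = some (.neg a)) :
    t.threadAt i = Thread.act a fun b => t.threadAt (if b then i + 2 else i + 1) := by
  rw [threadAt_of_jumpStep_eq_none (by simp [jumpStep, h]), layerAt, h]
  rfl

theorem Term.threadAt_halt {t : Term A} {i : ℕ} (h : t.get i = some .halt) :
    t.threadAt i = Thread.term := by
  rw [threadAt_of_jumpStep_eq_none (by simp [jumpStep, h]), layerAt, h]
  exact congrArg _ (map_term _)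

theorem Term.threadAt_jmp_succ {t : Term A} {i l : ℕ} (h : t.get i = some (.jmp (l + 1))) :
    t.threadAt i = t.threadAt (i + (l + 1)) :=
  threadAt_of_reaches (.single (by simp [jumpStep, h]))

theorem Term.threadAt_jmp_zero {t : Term A} {i : ℕ} (h : t.get i = some (.jmp 0)) :
    t.threadAt i = Thread.dead := by
  rw [threadAt_of_jumpStep_eq_none (by simp [jumpStep, h]), layerAt, h]
  exact congrArg _ (map_dead _)

theorem Term.threadAt_none {t : Term A} {i : ℕ} (h : t.get i = none) :
    t.threadAt i = Thread.dead := by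
  rw [threadAt_of_jumpStep_eq_none (by simp [jumpStep, h]), layerAt, h]
  exact congrArg _ (map_dead _)

theorem Term.threadAt_of_not_dom {t : Term A} {i : ℕ}
    (h : ¬ (StateTransition.eval t.jumpStep i).Dom) : t.threadAt i = Thread.dead := by
  rw [threadAt_eq, behave, dif_neg h]
  exact congrArg _ (map_dead _)

/-- Execution from position `i` is inaction, or a chain of jumps leads to an instruction that is
not a jump. -/
theorem Term.threadAt_eq_dead_or (t : Term A) (i : ℕ) :
    t.threadAt i = Thread.dead ∨ ∃ j, StateTransition.Reaches t.jumpStep i j ∧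
      (t.get j = some .halt ∨
        ∃ a, t.get j = some (.plain a) ∨ t.get j = some (.pos a) ∨ t.get j = some (.neg a)) := by
  by_cases hd : (StateTransition.eval t.jumpStep i).Dom
  · obtain ⟨hr, hn⟩ := StateTransition.mem_eval.1 (Part.get_mem hd)
    generalize (StateTransition.eval t.jumpStep i).get hd = j at *
    rw [threadAt_of_reaches hr]
    rcases hg : t.get j with _ | u
    · exact .inl (threadAt_none hg)
    · cases u with
      | jmp l =>
        cases l with
        | zero => exact .inl (threadAt_jmp_zero hg)
        | succ l => simp [jumpStep, hg] at hn
      | _ => exact .inr ⟨j, hr, by simp [hg]⟩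
  · exact .inl (threadAt_of_not_dom hd)

/-- The root of a thread. -/
def Thread.root (x : Thread A) : Node A := (PFunctor.M.dest x).1

@[simp] theorem Thread.root_term : (Thread.term : Thread A).root = .term := rfl
@[simp] theorem Thread.root_dead : (Thread.dead : Thread A).root = .dead := rfl
@[simp] theorem Thread.root_tau (x : Thread A) : (Thread.tau x).root = .tau := rfl
@[simp] theorem Thread.root_act (a : A) (f : Bool → Thread A) : (Thread.act a f).root = .act a :=
  rfl

theorem Thread.act_inj {a a' : A} {f f' : Bool → Thread A} (h : Thread.act a f = Thread.act a' f') :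
    a = a' ∧ f = f' := by
  have h' := PFunctor.M.mk_inj h
  cases congrArg Sigma.fst h'
  exact ⟨rfl, eq_of_heq (Sigma.mk.inj h').2⟩

end PGA

namespace RAM

open PGA StateTransition

theorem MState.set_apply (σ : MState) (i : ℕ) (w : List Bool) (j : ℕ) :
    (σ.set i w).1 j = if j = i then w else σ.1 j :=
  Function.update_apply σ.1 i w j

/-- The effect of a primitive instruction at position `i` on position and memory state. The jump
`#0` does not change the position, so that inaction becomes an infinite run. -/
def next : PInstr BInstr → ℕ → MState → Option (ℕ × MState)
  | .plain a, i, σ => some (i + 1, a.q σ)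
  | .pos a, i, σ => some (if a.p σ then i + 1 else i + 2, a.q σ)
  | .neg a, i, σ => some (if a.p σ then i + 2 else i + 1, a.q σ)
  | .jmp l, i, σ => some (i + l, σ)
  | .halt, _, _ => none

/-- The transition system on pairs of a position and a memory state given by the instruction
sequence of `t`. It stops exactly at termination instructions; beyond the end of the sequence it
runs forever. -/
noncomputable def step (t : Term BInstr) (c : ℕ × MState) : Option (ℕ × MState) :=
  match t.get c.1 with
  | some u => next u c.1 c.2
  | none => some c

theorem step_of_get {t : Term BInstr} {i : ℕ} {u : PInstr BInstr} (h : t.get i = some u)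
    (σ : MState) : step t (i, σ) = next u i σ := by
  simp only [step, h]

theorem step_eq_none_iff {t : Term BInstr} {c : ℕ × MState} :
    step t c = none ↔ t.get c.1 = some .halt := by
  unfold step
  rcases h : t.get c.1 with _ | u
  · simp
  · cases u <;> simp [next]

theorem reaches_of_jumpStep {t : Term BInstr} {i j : ℕ} (h : Reaches t.jumpStep i j) (σ : MState) :
    Reaches (step t) (i, σ) (j, σ) := by
  induction h with
  | refl => exact .refl
  | tail _ hab ih =>
    refine ih.tail ?_
    rename_i a b _
    unfold Term.jumpStep at hab
    split at hab
    · rename_i l hl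
      rw [step_of_get hl]
      cases hab
      rfl
    · cases hab

theorem Terminates.of_mem_eval {t : Term BInstr} {c d : ℕ × MState} (h : d ∈ eval (step t) c) :
    Terminates (t.threadAt c.1) c.2 d.2 := by
  refine evalInduction (C := fun c => Terminates (t.threadAt c.1) c.2 d.2) h ?_
  rintro ⟨i, σ⟩ hd ih
  obtain ⟨hr, hn⟩ := mem_eval.1 hd
  rcases hg : t.get i with _ | u
  · have hs : step t (i, σ) = some (i, σ) := by simp only [step, hg]
    exact ih _ hs
  · have hs := step_of_get hg σ
    cases u with
    | plain a =>
      rw [Term.threadAt_plain hg]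
      exact .act _ _ _ _ (ih _ hs)
    | pos a =>
      rw [Term.threadAt_pos hg]
      exact .act _ _ _ _ (ih _ hs)
    | neg a =>
      rw [Term.threadAt_neg hg]
      exact .act _ _ _ _ (ih _ hs)
    | jmp l =>
      cases l with
      | zero => exact ih _ hs
      | succ l =>
        rw [Term.threadAt_jmp_succ hg]
        exact ih _ hs
    | halt =>
      rw [Term.threadAt_halt hg]
      rcases Relation.ReflTransGen.cases_head hr with h | ⟨c, hc, -⟩
      · subst h
        exact .term _
      · rw [Option.mem_def, hs] at hc
        cases hc

theorem Terminates.exists_mem_eval {t : Term BInstr} {i : ℕ} {σ σ' : MState}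
    (h : Terminates (t.threadAt i) σ σ') : ∃ j, (j, σ') ∈ eval (step t) (i, σ) := by
  generalize hx : t.threadAt i = x at h
  induction h generalizing i with
  | term σ =>
    rcases t.threadAt_eq_dead_or i with hd | ⟨j, hr, hg | ⟨b, hg | hg | hg⟩⟩
    · simpa [hd] using congrArg Thread.root hx
    · exact ⟨j, mem_eval.2 ⟨reaches_of_jumpStep hr σ, step_eq_none_iff.2 hg⟩⟩
    all_goals rw [Term.threadAt_of_reaches hr] at hx
    · simpa [Term.threadAt_plain hg] using congrArg Thread.root hx
    · simpa [Term.threadAt_pos hg] using congrArg Thread.root hx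
    · simpa [Term.threadAt_neg hg] using congrArg Thread.root hx
  | tau x σ σ' _ ih =>
    rcases t.threadAt_eq_dead_or i with hd | ⟨j, hr, hg⟩
    · simpa [hd] using congrArg Thread.root hx
    rw [Term.threadAt_of_reaches hr] at hx
    rcases hg with hg | ⟨b, hg | hg | hg⟩
    · simpa [Term.threadAt_halt hg] using congrArg Thread.root hx
    · simpa [Term.threadAt_plain hg] using congrArg Thread.root hx
    · simpa [Term.threadAt_pos hg] using congrArg Thread.root hx
    · simpa [Term.threadAt_neg hg] using congrArg Thread.root hx
  | act a f σ σ' _ ih =>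
    rcases t.threadAt_eq_dead_or i with hd | ⟨j, hr, hg⟩
    · simpa [hd] using congrArg Thread.root hx
    rw [Term.threadAt_of_reaches hr] at hx
    rw [reaches_eval (reaches_of_jumpStep hr σ)]
    -- a basic action of the instruction at position `j` is one step of the transition system
    have one : ∀ k, step t (j, σ) = some (k, a.q σ) → t.threadAt k = f (a.p σ) →
        ∃ j', (j', σ') ∈ eval (step t) (j, σ) := fun k hs hk => by
      obtain ⟨j', hj'⟩ := ih hk
      exact ⟨j', by rwa [reaches_eval (.single hs)]⟩
    rcases hg with hg | ⟨b, hg | hg | hg⟩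
    · simpa [Term.threadAt_halt hg] using congrArg Thread.root hx
    all_goals have hs := step_of_get hg σ
    · obtain ⟨rfl, rfl⟩ := Thread.act_inj ((Term.threadAt_plain hg).symm.trans hx)
      exact one _ hs rfl
    · obtain ⟨rfl, rfl⟩ := Thread.act_inj ((Term.threadAt_pos hg).symm.trans hx)
      exact one _ hs rfl
    · obtain ⟨rfl, rfl⟩ := Thread.act_inj ((Term.threadAt_neg hg).symm.trans hx)
      exact one _ hs rfl

/-- Application of an extracted thread to a memory is the evaluation of the transition system. -/
theorem terminates_extract_iff {t : Term BInstr} {σ σ' : MState} :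
    Terminates t.extract σ σ' ↔ ∃ j, (j, σ') ∈ eval (step t) (0, σ) :=
  ⟨fun h => Terminates.exists_mem_eval (i := 0) h, fun ⟨_, h⟩ => Terminates.of_mem_eval h⟩

theorem apply_extract_eq_op_iff {t : Term BInstr} {σ σ' : MState} :
    apply t.extract (.op σ) = .op σ' ↔ ∃ j, (j, σ') ∈ eval (step t) (0, σ) := by
  rw [← terminates_extract_iff]
  unfold apply
  constructor
  · intro h
    dsimp only at h
    split at h
    · rename_i h'
      cases h
      exact h'.choose_spec
    · cases h
  · intro h
    have h' : ∃ σ', Terminates t.extract σ σ' := ⟨_, h⟩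
    obtain ⟨j, hj⟩ := terminates_extract_iff.1 h
    obtain ⟨k, hk⟩ := terminates_extract_iff.1 h'.choose_spec
    dsimp only
    rw [dif_pos h']
    exact congrArg Memory.op (congrArg Prod.snd (Part.mem_unique hk hj))

theorem apply_extract_eq_inop_iff {t : Term BInstr} {σ : MState} :
    apply t.extract (.op σ) = .inop ↔ ¬ (eval (step t) (0, σ)).Dom := by
  rw [Part.dom_iff_mem]
  have : (∃ c, c ∈ eval (step t) (0, σ)) ↔ ∃ σ', Terminates t.extract σ σ' := by
    simp only [terminates_extract_iff, Prod.exists]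
    exact exists_comm
  rw [this]
  unfold apply
  dsimp only
  split <;> simp_all

/-! ### Depth of a terminating use -/

theorem use_eq (x : Thread BInstr) (u : Memory) :
    use x u = PFunctor.M.mk ((threadF BInstr).map (fun p => use p.1 p.2) (useLayer (x, u))) :=
  PFunctor.M.corec_def _ _

theorem exists_depthUpTo_use_le {x : Thread BInstr} {σ σ' : MState} (h : Terminates x σ σ') :
    ∃ K, ∀ n, (use x (.op σ)).depthUpTo n ≤ K := by
  induction h with
  | term σ =>
    refine ⟨0, fun n => ?_⟩
    cases n with
    | zero => exact le_rfl
    | succ n => rw [use_eq]; exact le_rfl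
  | tau x σ σ' _ ih =>
    obtain ⟨K, hK⟩ := ih
    refine ⟨K + 1, fun n => ?_⟩
    cases n with
    | zero => exact Nat.zero_le _
    | succ n => rw [use_eq]; exact Nat.succ_le_succ (hK n)
  | act a f σ σ' _ ih =>
    obtain ⟨K, hK⟩ := ih
    refine ⟨K + 1, fun n => ?_⟩
    cases n with
    | zero => exact Nat.zero_le _
    | succ n => rw [use_eq]; exact Nat.succ_le_succ (hK n)

theorem finite_setOf_sum_length_eq (n m : ℕ) :
    {w : Fin n → List Bool | ∑ k, (w k).length = m}.Finite := by
  refine (Set.Finite.pi' fun _ : Fin n => List.finite_length_le Bool m).subset fun w hw k => ?_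
  have : (w k).length ≤ ∑ k, (w k).length :=
    Finset.single_le_sum (f := fun k => (w k).length) (fun _ _ => Nat.zero_le _) (Finset.mem_univ k)
  exact this.trans_eq hw

/-- Computation in the sense of threads and memories, in terms of the transition system. A time
bound always exists: there are finitely many inputs of a given total length. -/
theorem computes_iff {n : ℕ} {t : Term BInstr} {F : (Fin n → List Bool) →. List Bool} :
    Computes t F ↔
      (∀ w, ∀ v ∈ F w, ∃ c ∈ eval (step t) (0, MState.input w), c.2.1 0 = v) ∧
      (∀ w, ¬ (F w).Dom → ¬ (eval (step t) (0, MState.input w)).Dom) := by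
  constructor
  · rintro ⟨T, h1, h2⟩
    refine ⟨fun w v hv => ?_, fun w hw => apply_extract_eq_inop_iff.1 (h2 w hw)⟩
    obtain ⟨⟨σ, hσ⟩, -⟩ := h1 w v hv
    obtain ⟨j, hj⟩ := apply_extract_eq_op_iff.1 hσ
    exact ⟨_, hj, by simp [MState.set_apply]⟩
  · rintro ⟨h1, h2⟩
    have hK : ∀ w, ∃ K, (F w).Dom →
        ∀ m, (use t.extract (.op (MState.input w))).depthUpTo m ≤ K := fun w => by
      by_cases hw : (F w).Dom
      · obtain ⟨c, hc, -⟩ := h1 w _ (Part.get_mem hw)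
        obtain ⟨K, hK⟩ := exists_depthUpTo_use_le (terminates_extract_iff.2 ⟨c.1, hc⟩)
        exact ⟨K, fun _ => hK⟩
      · exact ⟨0, fun h => (hw h).elim⟩
    choose K hK using hK
    refine ⟨fun m => ∑ w ∈ (finite_setOf_sum_length_eq n m).toFinset, K w, fun w v hv => ⟨?_, ?_⟩,
      fun w hw => apply_extract_eq_inop_iff.2 (h2 w hw)⟩
    · obtain ⟨⟨j, σ⟩, hc, hv'⟩ := h1 w v hv
      refine ⟨σ, apply_extract_eq_op_iff.2 ⟨j, ?_⟩⟩
      have : σ.set 0 v = σ := Subtype.ext (by subst hv'; exact Function.update_eq_self _ _)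
      rwa [this]
    · refine iSup_le fun m => Nat.cast_le.2 ?_
      refine (hK w (Part.dom_iff_mem.2 ⟨v, hv⟩) m).trans ?_
      exact Finset.single_le_sum (f := K) (fun _ _ => Nat.zero_le _)
        ((Set.Finite.mem_toFinset _).2 rfl)

/-! ### Bodies of programs as lists of primitive instructions -/

/-- The term `t` represents the finite instruction sequence `l`. -/
def Represents (t : Term BInstr) (l : List (PInstr BInstr)) : Prop :=
  t.len = l.length ∧ ∀ i, t.get i = l[i]?

theorem Represents.instr (u : PInstr BInstr) : Represents (.instr u) [u] := by
  refine ⟨rfl, fun i => ?_⟩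
  cases i <;> simp [Term.get]

theorem Represents.conc {s t : Term BInstr} {k l : List (PInstr BInstr)} (hs : Represents s k)
    (ht : Represents t l) : Represents (.conc s t) (k ++ l) := by
  refine ⟨by simp [Term.len, hs.1, ht.1], fun i => ?_⟩
  simp only [Term.get, hs.1, Nat.cast_lt, hs.2, ht.2, ENat.toNat_natCast, List.getElem?_append]

/-- The instructions of a repetition. -/
theorem Represents.get_rep {s : Term BInstr} {l : List (PInstr BInstr)} (h : Represents s l)
    (i : ℕ) : (Term.rep s).get i = l[i % l.length]? := by
  rw [Term.get, h.1, ENat.toNat_natCast, h.2]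

/-- The primitive instructions from which the bodies of semi-realistic RAM programs are built. -/
inductive IsPrimitive : PInstr BInstr → Prop
  | bin (o : BinOp) (s₁ s₂ : Src) (d : Dst) : IsPrimitive (.plain (binInstr o s₁ s₂ d))
  | un (o : UnOp) (s₁ : Src) (d : Dst) : IsPrimitive (.plain (unInstr o s₁ d))
  | cmp (o : CmpOp) (s₁ s₂ : Src) : IsPrimitive (.pos (cmpInstr o s₁ s₂))
  | jmp (l : ℕ) : IsPrimitive (.jmp l)
  | halt : IsPrimitive .halt

theorem IsUnit.exists_represents {t : Term BInstr} (h : IsUnit t) :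
    ∃ l, Represents t l ∧ ∀ u ∈ l, IsPrimitive u := by
  cases h with
  | bin o s₁ s₂ d => exact ⟨_, .instr _, by simpa using .bin o s₁ s₂ d⟩
  | un o s₁ d => exact ⟨_, .instr _, by simpa using .un o s₁ d⟩
  | cmp o s₁ s₂ l =>
    exact ⟨_, .conc (.instr _) (.instr _), by simpa using ⟨.cmp o s₁ s₂, .jmp l⟩⟩
  | jmp l => exact ⟨_, .instr _, by simpa using .jmp l⟩
  | halt => exact ⟨_, .instr _, by simpa using .halt⟩

theorem IsBody.exists_represents {t : Term BInstr} (h : IsBody t) :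
    ∃ l, Represents t l ∧ ∀ u ∈ l, IsPrimitive u := by
  induction h with
  | single t ht => exact ht.exists_represents
  | cons t s ht _ ih =>
    obtain ⟨l, hl, hl'⟩ := ih
    obtain ⟨k, hk, hk'⟩ := ht.exists_represents
    exact ⟨k ++ l, hk.conc hl, by simpa [or_imp, forall_and] using ⟨hk', hl'⟩⟩

/-- The instruction sequences that are concatenations of units. -/
inductive IsCode : List (PInstr BInstr) → Prop
  | nil : IsCode []
  | cons {t : Term BInstr} {k l : List (PInstr BInstr)} :
      IsUnit t → Represents t k → IsCode l → IsCode (k ++ l)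

theorem IsCode.append {k l : List (PInstr BInstr)} (hk : IsCode k) (hl : IsCode l) :
    IsCode (k ++ l) := by
  induction hk with
  | nil => exact hl
  | cons ht hr _ ih => rw [List.append_assoc]; exact .cons ht hr ih

theorem IsCode.bin (o : BinOp) (s₁ s₂ : Src) (d : Dst) : IsCode [.plain (binInstr o s₁ s₂ d)] :=
  .cons (.bin o s₁ s₂ d) (.instr _) .nil

theorem IsCode.un (o : UnOp) (s₁ : Src) (d : Dst) : IsCode [.plain (unInstr o s₁ d)] :=
  .cons (.un o s₁ d) (.instr _) .nil

theorem IsCode.cmp (o : CmpOp) (s₁ s₂ : Src) (l : ℕ) :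
    IsCode [.pos (cmpInstr o s₁ s₂), .jmp l] :=
  .cons (.cmp o s₁ s₂ l) (.conc (.instr _) (.instr _)) .nil

theorem IsCode.jmp (l : ℕ) : IsCode [.jmp l] := .cons (.jmp l) (.instr _) .nil

theorem IsCode.halt : IsCode [.halt] := .cons .halt (.instr _) .nil

theorem IsCode.exists_isBody {l : List (PInstr BInstr)} (h : IsCode l) (hl : l ≠ []) :
    ∃ s, IsBody s ∧ Represents s l := by
  induction h with
  | nil => exact (hl rfl).elim
  | @cons t k l ht hr _ ih =>
    rcases eq_or_ne l [] with rfl | h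
    · exact ⟨t, .single t ht, by rwa [List.append_nil]⟩
    · obtain ⟨s, hs, hs'⟩ := ih h
      exact ⟨_, .cons t s ht hs, hr.conc hs'⟩

end RAM

/-! ### Programs define partial recursive functions -/

namespace RAM

open PGA StateTransition

/-- The memory state given by a finite list of register contents. -/
def toMem (r : List (List Bool)) : MState :=
  ⟨fun i => r.getD i [], r.length, fun j => by simp [List.getD]⟩

/-- Writing a register of a memory state that is given by a list, which is extended if needed. -/
def writeReg (r : List (List Bool)) (i : ℕ) (w : List Bool) : List (List Bool) :=
  (List.range (max r.length (i + 1))).map fun j => if j = i then w else r.getD j []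

theorem toMem_writeReg (r : List (List Bool)) (i : ℕ) (w : List Bool) :
    toMem (writeReg r i w) = (toMem r).set i w := by
  refine Subtype.ext (funext fun j => ?_)
  rw [MState.set_apply]
  simp only [toMem, writeReg, List.getD_eq_getElem?_getD, List.getElem?_map]
  by_cases h : j < max r.length (i + 1)
  · simp [List.getElem?_range h]
  · have h1 : (List.range (max r.length (i + 1)))[j]? = none := by simp; omega
    have h2 : r[j]? = none := by simp; omega
    have h3 : j ≠ i := by omega
    simp [h1, h2, h3]

theorem input_eq_toMem {n : ℕ} (w : Fin n → List Bool) :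
    MState.input w = toMem ([] :: List.ofFn w) := by
  refine Subtype.ext (funext fun j => ?_)
  simp only [toMem, MState.input]
  cases j with
  | zero => simp
  | succ j =>
    by_cases h : j < n
    · simp [Nat.succ_le_of_lt h]
    · simp [h]

theorem bitwise_eq_map_range (f : Bool → Bool → Bool) (a b : List Bool) :
    bitwise f a b =
      (List.range (max a.length b.length)).map fun i => f (a.getD i false) (b.getD i false) := by
  fun_induction bitwise f a b with
  | case1 => rfl
  | case2 b w ih => simp [ih, List.range_succ_eq_map, Function.comp_def]
  | case3 b w ih => simp [ih, List.range_succ_eq_map, Function.comp_def]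
  | case4 b₁ w₁ b₂ w₂ ih =>
    rw [List.length_cons, List.length_cons, Nat.succ_max_succ, List.range_succ_eq_map]
    simp [ih, Function.comp_def]

theorem primrec_writeReg {α : Type*} [Primcodable α] {r : α → List (List Bool)} {i : α → ℕ}
    {w : α → List Bool} (hr : Primrec r) (hi : Primrec i) (hw : Primrec w) :
    Primrec fun a => writeReg (r a) (i a) (w a) := by
  refine Primrec.list_map ?_ ?_
  · exact Primrec.list_range.comp
      (Primrec.nat_max.comp (Primrec.list_length.comp hr) (Primrec.succ.comp hi))
  · refine Primrec.ite ?_ (hw.comp Primrec.fst) ?_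
    · exact Primrec.eq.comp Primrec.snd (hi.comp Primrec.fst)
    · exact (Primrec.list_getD []).comp (hr.comp Primrec.fst) Primrec.snd

theorem primrec_bton : Primrec bton := by
  have h : Primrec fun w : List Bool => w.foldr (fun b s => 2 * s + b.toNat) 0 := by
    refine Primrec.list_foldr (h := fun _ (p : Bool × ℕ) => 2 * p.2 + p.1.toNat) Primrec.id
      (Primrec.const 0) ?_
    refine Primrec.nat_add.comp ?_ ?_
    · exact Primrec.nat_double.comp (Primrec.snd.comp Primrec.snd)
    · exact (Primrec.dom_bool Bool.toNat).comp (Primrec.fst.comp Primrec.snd)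
  refine h.of_eq fun w => ?_
  induction w with
  | nil => rfl
  | cons b w ih => simp only [List.foldr_cons, ih, bton]

theorem primrec_ntob : Primrec ntob := by
  have h : Primrec₂ fun (_ : Unit) (n : ℕ) => ntob n := by
    refine Primrec.nat_strong_rec _ (g := fun _ l => some (if l.length ≤ 1 then
      [decide (l.length = 1)] else decide (l.length % 2 = 1) :: l.getD (l.length / 2) [])) ?_ ?_
    · have hl : Primrec fun p : Unit × List (List Bool) => p.2.length :=
        Primrec.list_length.comp Primrec.snd
      refine Primrec.option_some.comp (Primrec.ite ?_ ?_ ?_)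
      · exact Primrec.nat_le.comp hl (Primrec.const 1)
      · exact Primrec.list_cons.comp (Primrec.eq.decide.comp hl (Primrec.const 1))
          (Primrec.const [])
      · refine Primrec.list_cons.comp ?_ ?_
        · exact Primrec.eq.decide.comp (Primrec.nat_mod.comp hl (Primrec.const 2))
            (Primrec.const 1)
        · exact (Primrec.list_getD []).comp Primrec.snd
            (Primrec.nat_div.comp hl (Primrec.const 2))
    · intro _ n
      conv_rhs => rw [ntob]
      by_cases hn : n ≤ 1
      · simp [hn]
      · have : n / 2 < n := by omega
        simp [hn, List.getD, this]
  exact (h.comp (Primrec.const ()) Primrec.id).of_eq fun _ => rfl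

theorem primrec_bitwise (f : Bool → Bool → Bool) : Primrec₂ (bitwise f) := by
  have h : Primrec fun p : List Bool × List Bool => (List.range (max p.1.length p.2.length)).map
      fun i => f (p.1.getD i false) (p.2.getD i false) := by
    refine Primrec.list_map ?_ ?_
    · exact Primrec.list_range.comp (Primrec.nat_max.comp
        (Primrec.list_length.comp Primrec.fst) (Primrec.list_length.comp Primrec.snd))
    · refine (Primrec.dom_bool₂ f).comp ?_ ?_
      · exact (Primrec.list_getD false).comp (Primrec.fst.comp Primrec.fst) Primrec.snd
      · exact (Primrec.list_getD false).comp (Primrec.snd.comp Primrec.fst) Primrec.snd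
  exact h.of_eq fun p => (bitwise_eq_map_range f p.1 p.2).symm

theorem primrec_binOp (o : BinOp) : Primrec₂ o.eval := by
  have h1 : Primrec fun p : List Bool × List Bool => bton p.1 := primrec_bton.comp Primrec.fst
  have h2 : Primrec fun p : List Bool × List Bool => bton p.2 := primrec_bton.comp Primrec.snd
  cases o with
  | add => exact primrec_ntob.comp (Primrec.nat_add.comp h1 h2)
  | sub => exact primrec_ntob.comp (Primrec.nat_sub.comp h1 h2)
  | mul => exact primrec_ntob.comp (Primrec.nat_mul.comp h1 h2)
  | div => exact primrec_ntob.comp (Primrec.nat_div.comp h1 h2)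
  | and => exact primrec_bitwise _
  | or => exact primrec_bitwise _
  | xor => exact primrec_bitwise _

theorem primrec_unOp (o : UnOp) : Primrec o.eval := by
  cases o with
  | not => exact Primrec.list_map Primrec.id (Primrec.not.comp Primrec.snd)
  | shl =>
    refine (Primrec.list_casesOn (f := id) (g := fun _ => ([] : List Bool))
      (h := fun _ p => false :: p.1 :: p.2) Primrec.id (Primrec.const []) ?_).of_eq fun w => ?_
    · exact Primrec.list_cons.comp (Primrec.const false)
        (Primrec.list_cons.comp (Primrec.fst.comp Primrec.snd) (Primrec.snd.comp Primrec.snd))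
    · cases w <;> rfl
  | shr => exact Primrec.list_tail.of_eq fun w => by cases w <;> rfl
  | rol =>
    refine (Primrec.list_casesOn (f := List.reverse) (g := fun _ => ([] : List Bool))
      (h := fun _ p => p.1 :: p.2.reverse) Primrec.list_reverse (Primrec.const []) ?_).of_eq
      fun w => ?_
    · exact Primrec.list_cons.comp (Primrec.fst.comp Primrec.snd)
        (Primrec.list_reverse.comp (Primrec.snd.comp Primrec.snd))
    · rcases List.eq_nil_or_concat' w with rfl | ⟨u, b, rfl⟩
      · rfl
      · have : ∀ x : List Bool, ∀ hx : x ≠ [], rol x = x.getLast hx :: x.dropLast := by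
          intro x hx
          cases x with
          | nil => exact (hx rfl).elim
          | cons => rfl
        simp [UnOp.eval, this (u ++ [b]) (by simp)]
  | ror =>
    refine (Primrec.list_casesOn (f := id) (g := fun _ => ([] : List Bool))
      (h := fun _ p => p.2 ++ [p.1]) Primrec.id (Primrec.const []) ?_).of_eq fun w => ?_
    · exact Primrec.list_concat.comp (Primrec.snd.comp Primrec.snd) (Primrec.fst.comp Primrec.snd)
    · cases w <;> rfl
  | mov => exact Primrec.id

theorem primrec_cmpOp (o : CmpOp) : Primrec₂ o.eval := by
  have h1 : Primrec fun p : List Bool × List Bool => bton p.1 := primrec_bton.comp Primrec.fst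
  have h2 : Primrec fun p : List Bool × List Bool => bton p.2 := primrec_bton.comp Primrec.snd
  cases o with
  | eq => exact Primrec.eq.decide.comp h1 h2
  | gt => exact Primrec.nat_lt.decide.comp h2 h1

theorem primrec_src (s : Src) : Primrec fun r => s.val (toMem r) := by
  cases s with
  | imm i => exact Primrec.const (ntob i)
  | dir i => exact (Primrec.list_getD []).comp Primrec.id (Primrec.const i)
  | ind i =>
    exact (Primrec.list_getD []).comp Primrec.id
      (primrec_bton.comp ((Primrec.list_getD []).comp Primrec.id (Primrec.const i)))

theorem primrec_dst (d : Dst) : Primrec fun r => d.reg (toMem r) := by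
  cases d with
  | dir i => exact Primrec.const i
  | ind i => exact primrec_bton.comp ((Primrec.list_getD []).comp Primrec.id (Primrec.const i))

/-- The effect of the instructions of a program is primitive recursive in the list representation
of memory states. -/
theorem IsPrimitive.exists_primrec {u : PInstr BInstr} (h : IsPrimitive u) :
    ∃ g : ℕ × List (List Bool) → Option (ℕ × List (List Bool)), Primrec g ∧
      ∀ i r, next u i (toMem r) = (g (i, r)).map (Prod.map id toMem) := by
  have hr : Primrec fun c : ℕ × List (List Bool) => c.2 := Primrec.snd
  have hi : Primrec fun c : ℕ × List (List Bool) => c.1 := Primrec.fst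
  cases h with
  | bin o s₁ s₂ d =>
    refine ⟨fun c => some (c.1 + 1, writeReg c.2 (d.reg (toMem c.2))
      (o.eval (s₁.val (toMem c.2)) (s₂.val (toMem c.2)))), ?_, fun i r => ?_⟩
    · exact Primrec.option_some.comp (Primrec.pair (Primrec.succ.comp hi)
        (primrec_writeReg hr ((primrec_dst d).comp hr)
          ((primrec_binOp o).comp ((primrec_src s₁).comp hr) ((primrec_src s₂).comp hr))))
    · simp [next, binInstr, toMem_writeReg]
  | un o s₁ d =>
    refine ⟨fun c => some (c.1 + 1, writeReg c.2 (d.reg (toMem c.2))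
      (o.eval (s₁.val (toMem c.2)))), ?_, fun i r => ?_⟩
    · exact Primrec.option_some.comp (Primrec.pair (Primrec.succ.comp hi)
        (primrec_writeReg hr ((primrec_dst d).comp hr)
          ((primrec_unOp o).comp ((primrec_src s₁).comp hr))))
    · simp [next, unInstr, toMem_writeReg]
  | cmp o s₁ s₂ =>
    refine ⟨fun c => some (bif o.eval (s₁.val (toMem c.2)) (s₂.val (toMem c.2)) then c.1 + 1
      else c.1 + 2, c.2), ?_, fun i r => ?_⟩
    · exact Primrec.option_some.comp (Primrec.pair (Primrec.cond
        ((primrec_cmpOp o).comp ((primrec_src s₁).comp hr) ((primrec_src s₂).comp hr))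
        (Primrec.nat_add.comp hi (Primrec.const 1)) (Primrec.nat_add.comp hi (Primrec.const 2))) hr)
    · simp only [next, cmpInstr, cond_eq_ite]
      rfl
  | jmp l =>
    exact ⟨fun c => some (c.1 + l, c.2), Primrec.option_some.comp (Primrec.pair
      (Primrec.nat_add.comp hi (Primrec.const l)) hr), fun i r => rfl⟩
  | halt => exact ⟨fun _ => none, Primrec.const none, fun i r => rfl⟩

/-- The transition system of a finite instruction sequence is primitive recursive in the list
representation of memory states. -/
theorem exists_primrec_fetch (l : List (PInstr BInstr)) (hl : ∀ u ∈ l, IsPrimitive u) :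
    ∃ g : ℕ → ℕ × List (List Bool) → Option (ℕ × List (List Bool)), Primrec₂ g ∧
      ∀ j i r, (match l[j]? with
        | some u => next u i (toMem r)
        | none => some (i, toMem r)) = (g j (i, r)).map (Prod.map id toMem) := by
  induction l with
  | nil => exact ⟨fun _ c => some c, Primrec.option_some.comp Primrec.snd, fun j i r => rfl⟩
  | cons u l ih =>
    obtain ⟨g, hg, hg'⟩ := ih fun v hv => hl v (List.mem_cons_of_mem _ hv)
    obtain ⟨f, hf, hf'⟩ := (hl u List.mem_cons_self).exists_primrec
    refine ⟨fun j c => Nat.casesOn j (f c) fun k => g k c, ?_, fun j i r => ?_⟩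
    · exact Primrec.nat_casesOn Primrec.fst (hf.comp Primrec.snd)
        (hg.comp Primrec.snd (Primrec.snd.comp Primrec.fst))
    · cases j with
      | zero => exact hf' i r
      | succ j => simpa using hg' j i r

theorem partrec_eval {α : Type*} [Primcodable α] {f : α → Option α} (hf : Computable f) :
    Partrec (eval f) := by
  have h : Computable fun s => ((f s).elim (Sum.inl s) Sum.inr : α ⊕ α) := by
    refine (Computable.option_casesOn hf Computable.sumInl
      (Computable.sumInr.comp Computable.snd).to₂).of_eq fun a => ?_
    cases f a <;> rfl
  exact Partrec.fix h.partrec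

/-- Functions that are computed by semi-realistic RAM programs are partial recursive. -/
theorem partrec_of_computes {n : ℕ} {F : (Fin n → List Bool) →. List Bool} {P : Term BInstr}
    (hP : IsSRRAMProgram P) (hF : Computes P F) : Partrec F := by
  obtain ⟨s, hs, rfl⟩ := hP
  obtain ⟨l, hl, hl'⟩ := hs.exists_represents
  obtain ⟨g, hg, hg'⟩ := exists_primrec_fetch l hl'
  obtain ⟨h1, h2⟩ := computes_iff.1 hF
  let f : ℕ × List (List Bool) → Option (ℕ × List (List Bool)) := fun c => g (c.1 % l.length) c
  have hf : Primrec f :=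
    hg.comp (Primrec.nat_mod.comp Primrec.fst (Primrec.const l.length)) Primrec.id
  have hstep : ∀ c, step (.rep s) (Prod.map id toMem c) = (f c).map (Prod.map id toMem) := by
    rintro ⟨i, r⟩
    rw [← hg']
    simp only [step, Prod.map, hl.get_rep, id]
  have heval : ∀ c, eval (step (.rep s)) (Prod.map id toMem c) = Prod.map id toMem <$> eval f c := by
    refine tr_eval' _ _ _ (fun_respects.2 fun c => ?_)
    have := hstep c
    rcases hc : f c with _ | d
    · rwa [hc] at this
    · rw [hc] at this
      exact .single this
  have hpr : Primrec fun w : Fin n → List Bool =>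
      ((0, [] :: List.ofFn w) : ℕ × List (List Bool)) :=
    Primrec.pair (Primrec.const 0) (Primrec.list_cons.comp (Primrec.const [])
      ((Primrec.vector_toList.comp Primrec.vector_ofFn').of_eq fun w => by simp))
  have hG : Partrec fun w : Fin n → List Bool =>
      (eval f (0, [] :: List.ofFn w)).map fun c => c.2.getD 0 [] :=
    ((partrec_eval hf.to_comp).comp hpr.to_comp).map
      (((Primrec.list_getD []).comp (Primrec.snd.comp Primrec.snd) (Primrec.const 0)).to_comp)
  refine hG.of_eq fun w => ?_
  have hin : eval (step (.rep s)) (0, MState.input w) =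
      Prod.map id toMem <$> eval f (0, [] :: List.ofFn w) := by
    rw [← heval, input_eq_toMem]; rfl
  by_cases hw : (F w).Dom
  · obtain ⟨c, hc, hv⟩ := h1 w _ (Part.get_mem hw)
    rw [hin] at hc
    obtain ⟨d, hd, rfl⟩ := (Part.mem_map_iff _).1 hc
    rw [Part.eq_some_iff.2 (Part.get_mem hw), Part.eq_some_iff.2 hd, Part.map_some, ← hv]
    rfl
  · have := h2 w hw
    rw [hin] at this
    rw [Part.eq_none_iff'.2 hw, Part.eq_none_iff']
    exact this

end RAM

/-! ### Turing machines with a prologue and an epilogue -/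

namespace Turing.TM0

open StateTransition

/-- The states of a machine that is restricted to the states in `S` and is preceded and followed by
one step. -/
inductive FrameState {Λ : Type*} (S : Set Λ)
  | start
  | run (q : S)
  | final

variable {Γ Λ : Type*} {S : Set Λ}

instance [Finite S] : Finite (FrameState S) :=
  Finite.of_surjective (fun o : Option (Option S) => match o with
    | none => .start
    | some none => .final
    | some (some q) => .run q) fun q => by
      cases q with
      | start => exact ⟨none, rfl⟩
      | run q => exact ⟨some (some q), rfl⟩
      | final => exact ⟨some none, rfl⟩

instance : Inhabited (FrameState S) := ⟨.start⟩

variable [Inhabited Λ] [Inhabited Γ]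

open Classical in
/-- The machine that replaces the scanned symbol `a` by `f a`, continues as `M` does with states in
`S`, and moves one cell to the right before it halts. -/
noncomputable def frame (M : Machine Γ Λ) (S : Set Λ) (f : Γ → Γ) : Machine Γ (FrameState S)
  | .start, a => if h : default ∈ S then some (.run ⟨default, h⟩, .write (f a)) else none
  | .run q, a => match M q a with
    | some (q', s) => if h : q' ∈ S then some (.run ⟨q', h⟩, s) else none
    | none => some (.final, .move .right)
  | .final, _ => none

/-- The configuration of `frame M S f` that corresponds to a configuration of `M`. -/
def FrameRel (S : Set Λ) (c : Cfg Γ Λ) (d : Cfg Γ (FrameState S)) : Prop :=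
  ∃ h : c.q ∈ S, d = ⟨.run ⟨c.q, h⟩, c.Tape⟩

variable {M : Machine Γ Λ} {f : Γ → Γ}

theorem frame_simulates (hS : Supports M S) :
    Simulates (step M) (step (frame M S f)) (FrameRel S) := by
  rintro ⟨q, T⟩ c' _ ⟨hq, rfl⟩ hstep
  have hq' : c'.q ∈ S := step_supports M hS hstep hq
  refine ⟨_, ⟨hq', rfl⟩, .single ?_⟩
  unfold step at hstep
  rcases hM : M q T.head with _ | ⟨q', s⟩
  · simp [hM] at hstep
  · simp only [hM, Option.map_some, Option.some.injEq] at hstep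
    subst hstep
    simp [step, frame, hM, show q' ∈ S from hq']

theorem frame_reaches_init (hS : Supports M S) (l : List Γ) :
    ∃ d, FrameRel S ⟨default, Tape.mk₁ (f l.headI :: l.tail)⟩ d ∧
      Reaches₁ (step (frame M S f)) (init l) d := by
  refine ⟨_, ⟨hS.1, rfl⟩, .single ?_⟩
  have h : default ∈ S := hS.1
  cases l <;> simp [step, init, frame, default, h] <;> rfl

/-- If `M` halts on the tape with the changed first symbol, then `frame M S f` yields what is to the
right of the head. -/
theorem mem_eval_frame (hS : Supports M S) {l : List Γ} {L : ListBlank Γ}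
    (h : L ∈ eval M (f l.headI :: l.tail)) : L.tail ∈ eval (frame M S f) l := by
  obtain ⟨c, hc, rfl⟩ := (Part.mem_map_iff _).1 h
  obtain ⟨hr, hn⟩ := mem_eval.1 hc
  obtain ⟨d, hd, hd'⟩ := frame_reaches_init (f := f) hS l
  obtain ⟨_, ⟨hq, rfl⟩, hr'⟩ := (frame_simulates (f := f) hS).reaches hd hr
  refine (Part.mem_map_iff _).2 ⟨⟨.final, c.Tape.move .right⟩, mem_eval.2 ⟨?_, rfl⟩, ?_⟩
  · refine (hd'.to_reflTransGen.trans hr').tail ?_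
    obtain ⟨q, T⟩ := c
    have : M q T.head = none := by simpa [step] using hn
    simp [step, frame, this]
  · simp [Tape.right₀, Tape.move]

theorem not_dom_eval_frame (hS : Supports M S) {l : List Γ}
    (h : ¬ (eval M (f l.headI :: l.tail)).Dom) : ¬ (eval (frame M S f) l).Dom := by
  obtain ⟨d, hd, hd'⟩ := frame_reaches_init (f := f) hS l
  show ¬ (StateTransition.eval _ _).Dom
  rw [reaches_eval hd'.to_reflTransGen]
  exact (frame_simulates hS).not_dom hd h

end Turing.TM0

/-! ### A stack machine that reads and writes symbol sequences -/

namespace Turing.StackIO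

open StateTransition ToPartrec PartrecToTM2 TM2.Stmt

/-- The program positions of the stack machine: those of Mathlib's evaluator, and those of loops
that translate the input before and the output after the evaluation. -/
inductive Label
  | start
  | read
  | sim (q : Λ')
  | out
  | write

instance : Inhabited Label := ⟨.start⟩

/-- Statements of stack machines with the four stacks of Mathlib's evaluator. -/
abbrev Stm (Λ : Type) := TM2.Stmt (fun _ : K' => Γ') Λ (Option Γ')

/-- Embedding of the statements of the evaluator, with the output loop in place of halting. -/
def embed : Stm Λ' → Stm Label
  | push k f q => push k f (embed q)
  | peek k f q => peek k f (embed q)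
  | pop k f q => pop k f (embed q)
  | load f q => load f (embed q)
  | branch p q₁ q₂ => branch p (embed q₁) (embed q₂)
  | goto l => goto fun v => .sim (l v)
  | TM2.Stmt.halt => goto fun _ => .out

/-- The first of the two binary digits for an input symbol. -/
def lowDigit (s : Option Γ') : Γ' := if s = some .bit1 then .bit1 else .bit0

/-- The second of the two binary digits for an input symbol. -/
def highDigit (s : Option Γ') : Γ' := if s = some .consₗ then .bit1 else .bit0

/-- The stack machine for the code `c`. The input, over the symbols `bit0`, `bit1` and `consₗ`, is
on the stack `aux` with its last symbol on top. Popping it from there, a binary number with two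
digits per symbol is pushed on `main`. In the end the digits of the result are moved from `main`
to `aux`, on top of an extra symbol at the bottom and without the most significant digit. -/
def machine (c : Code) : Label → Stm Label
  | .start => push .main (fun _ => .cons) <| goto fun _ => .read
  | .read => pop .aux (fun _ s => s) <| branch Option.isSome
      (push .main highDigit <| push .main lowDigit <| goto fun _ => .read)
      (goto fun _ => .sim (trNormal c Cont'.halt))
  | .sim q => embed (tr q)
  | .out => push .aux (fun _ => .consₗ) <| goto fun _ => .write
  | .write => pop .main (fun _ s => s) <| branch (fun s => s = some .cons)
      (pop .aux (fun _ s => s) TM2.Stmt.halt)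
      (push .aux (fun s => s.getD .consₗ) <| goto fun _ => .write)

/-- Configurations of the stack machine. -/
abbrev Conf (Λ : Type) := TM2.Cfg (fun _ : K' => Γ') Λ (Option Γ')

/-- The configuration that corresponds to a configuration of the evaluator. -/
def embedCfg (x : Conf Λ') : Conf Label := ⟨some (x.l.elim .out .sim), x.var, x.stk⟩

theorem stepAux_embed (q : Stm Λ') (v : Option Γ') (S : K' → List Γ') :
    TM2.stepAux (embed q) v S = embedCfg (TM2.stepAux q v S) := by
  induction q generalizing v S with
  | push k f q ih => exact ih _ _
  | peek k f q ih => exact ih _ _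
  | pop k f q ih => exact ih _ _
  | load f q ih => exact ih _ _
  | branch p q₁ q₂ ih₁ ih₂ =>
    simp only [embed, TM2.stepAux]
    cases p v
    · exact ih₂ _ _
    · exact ih₁ _ _
  | goto l => rfl
  | halt => rfl

theorem simulates (c : Code) :
    Simulates (TM2.step tr) (TM2.step (machine c)) fun x y => embedCfg x = y := by
  rintro ⟨_ | l, v, S⟩ b _ rfl h
  · cases h
  · refine ⟨_, rfl, .single ?_⟩
    cases h
    exact congrArg some (stepAux_embed _ _ _)

theorem reaches_read (c : Code) (L m : List Γ') (v : Option Γ') :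
    Reaches (TM2.step (machine c)) ⟨some .read, v, K'.elim m [] L []⟩
      ⟨some (.sim (trNormal c Cont'.halt)), none, K'.elim
        (L.reverse.flatMap (fun s => [lowDigit (some s), highDigit (some s)]) ++ m) [] [] []⟩ := by
  induction L generalizing m v with
  | nil => exact .single (by simp [machine])
  | cons s L ih =>
    refine .head (b := ⟨some .read, some s,
      K'.elim (lowDigit (some s) :: highDigit (some s) :: m) [] L []⟩) (by simp [machine]) ?_
    simpa using ih _ _

theorem reaches_write (c : Code) (u a : List Γ') (hu : .cons ∉ u) (v : Option Γ') :
    ∃ v', Reaches (TM2.step (machine c)) ⟨some .write, v, K'.elim (u ++ [.cons]) [] a []⟩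
      ⟨none, v', K'.elim [] [] (u.reverse ++ a).tail []⟩ := by
  induction u generalizing a v with
  | nil => exact ⟨_, .single (by simp [machine]; rfl)⟩
  | cons s u ih =>
    obtain ⟨v', h⟩ := ih (s :: a) (fun h => hu (List.mem_cons_of_mem _ h)) (some s)
    refine ⟨v', .head ?_ (by simpa using h)⟩
    have : s ≠ .cons := fun h => hu (h ▸ List.mem_cons_self)
    simp [machine, this]

theorem reaches_start (c : Code) (L : List Γ') {m : ℕ}
    (hm : trNat m = L.flatMap fun s => [lowDigit (some s), highDigit (some s)]) :
    Reaches (TM2.step (machine c)) (TM2.init .aux L.reverse) (embedCfg (init c [m])) := by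
  have h0 : (TM2.init .aux L.reverse : Conf Label) =
      ⟨some .start, none, K'.elim [] [] L.reverse []⟩ := by
    refine congrArg (TM2.Cfg.mk _ _) (funext fun k => ?_)
    cases k <;> rfl
  rw [h0]
  refine .head (b := ⟨some .read, none, K'.elim [.cons] [] L.reverse []⟩) (by simp [machine]) ?_
  have := reaches_read c L.reverse [.cons] none
  rw [List.reverse_reverse, ← hm] at this
  exact this

theorem mem_eval (c : Code) (L : List Γ') {m k : ℕ} {u : List Γ'}
    (hm : trNat m = L.flatMap fun s => [lowDigit (some s), highDigit (some s)])
    (hk : trNat k = u ++ [.bit1]) (hu : .cons ∉ u) (h : [k] ∈ c.eval [m]) :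
    ∃ v, ⟨none, v, K'.elim [] [] (u.reverse ++ [.consₗ]) []⟩ ∈
      eval (TM2.step (machine c)) (TM2.init .aux L.reverse) := by
  have h1 : PartrecToTM2.halt [k] ∈ eval (TM2.step tr) (init c [m]) := by
    rw [PartrecToTM2.tr_eval]; exact (Part.mem_map_iff _).2 ⟨_, h, rfl⟩
  obtain ⟨_, rfl, h2⟩ := (simulates c).reaches rfl (StateTransition.mem_eval.1 h1).1
  obtain ⟨v, h3⟩ := reaches_write c (u ++ [.bit1]) [.consₗ] (by simp [hu]) none
  refine ⟨v, StateTransition.mem_eval.2 ⟨((reaches_start c L hm).trans h2).trans ?_, rfl⟩⟩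
  refine Reaches.head
    (b := ⟨some .write, none, K'.elim (u ++ [.bit1] ++ [.cons]) [] [.consₗ] []⟩) ?_ ?_
  · show TM2.step (machine c) ⟨some .out, none, K'.elim (trList [k]) [] [] []⟩ = _
    simp [machine, hk]
  · simpa using h3

theorem not_dom_eval (c : Code) (L : List Γ') {m : ℕ}
    (hm : trNat m = L.flatMap fun s => [lowDigit (some s), highDigit (some s)])
    (h : ¬ (c.eval [m]).Dom) :
    ¬ (eval (TM2.step (machine c)) (TM2.init .aux L.reverse)).Dom := by
  rw [reaches_eval (reaches_start c L hm)]
  refine (simulates c).not_dom rfl ?_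
  rw [PartrecToTM2.tr_eval]
  exact h

theorem supportsStmt_embed {S : Finset Λ'} {T : Finset Label} (hST : ∀ q ∈ S, .sim q ∈ T)
    (hout : .out ∈ T) {q : Stm Λ'} (h : TM2.SupportsStmt S q) :
    TM2.SupportsStmt T (embed q) := by
  induction q with
  | push k f q ih => exact ih h
  | peek k f q ih => exact ih h
  | pop k f q ih => exact ih h
  | load f q ih => exact ih h
  | branch p q₁ q₂ ih₁ ih₂ => exact ⟨ih₁ h.1, ih₂ h.2⟩
  | goto l => exact fun v => hST _ (h v)
  | halt => exact fun _ => hout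

theorem exists_supports (c : Code) : ∃ T, TM2.Supports (machine c) T := by
  classical
  have hs := tr_supports c Cont'.halt
  refine ⟨(codeSupp c Cont'.halt).image Label.sim ∪ {.start, .read, .out, .write}, by
    simp [default], fun q hq => ?_⟩
  have hsim : ∀ q ∈ codeSupp c Cont'.halt, Label.sim q ∈
      ((codeSupp c Cont'.halt).image Label.sim ∪ {.start, .read, .out, .write} : Finset Label) :=
    fun q hq => Finset.mem_union_left _ (Finset.mem_image_of_mem _ hq)
  cases q with
  | start => simp [machine, TM2.SupportsStmt]
  | read =>
    refine ⟨by simp [TM2.SupportsStmt], fun _ => hsim _ hs.1⟩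
  | sim q =>
    refine supportsStmt_embed hsim (by simp) (hs.2 q ?_)
    simpa using hq
  | out => simp [machine, TM2.SupportsStmt]
  | write => simp [machine, TM2.SupportsStmt]

end Turing.StackIO

/-! ### Binary codes of inputs and outputs -/

namespace Turing.StackIO

open StateTransition ToPartrec PartrecToTM2

/-- The symbol for a bit. -/
def bitSymbol (b : Bool) : Γ' := bif b then .bit1 else .bit0

/-- The two binary digits for an input symbol. -/
def digits (s : Γ') : List Γ' := [lowDigit (some s), highDigit (some s)]

theorem trNat_two_mul {k : ℕ} (hk : 0 < k) : trNat (2 * k) = .bit0 :: trNat k := by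
  unfold trNat
  rw [Nat.cast_mul, Nat.cast_ofNat, two_mul, Num.bit0_of_bit0]
  rcases h : (k : Num) with _ | p
  · have : (k : Num) = ((0 : ℕ) : Num) := by rw [h]; rfl
    exact absurd (Nat.cast_injective this) hk.ne'
  · rfl

theorem trNat_two_mul_add_one (k : ℕ) : trNat (2 * k + 1) = .bit1 :: trNat k := by
  unfold trNat
  rw [Nat.cast_add, Nat.cast_mul, Nat.cast_ofNat, two_mul, Nat.cast_one, Num.bit1_of_bit1]
  rcases (k : Num) with _ | p <;> rfl

theorem trNat_one : trNat 1 = [.bit1] := by simpa using trNat_two_mul_add_one 0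

/-- The number whose base-4 digits, least significant first, are the bits of `v`, followed by those
of `k`. -/
def wordCode (v : List Bool) (k : ℕ) : ℕ := v.foldr (fun b a => 4 * a + b.toNat) k

/-- The number whose base-4 digits, least significant first, are the symbols of `w₁ # … wₙ #`, where
the digit `2` stands for `#`. -/
def wordsCode (ws : List (List Bool)) : ℕ := ws.foldr (fun v k => wordCode v (4 * k + 2)) 0

/-- The number whose binary representation is that of `v` with the digit `1` added at the most
significant end. -/
def outCode (v : List Bool) : ℕ := v.foldr (fun b a => 2 * a + b.toNat) 1

theorem wordCode_pos (v : List Bool) {k : ℕ} (hk : 0 < k) : 0 < wordCode v k := by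
  induction v with
  | nil => exact hk
  | cons b v ih => simp only [wordCode, List.foldr_cons] at ih ⊢; omega

theorem trNat_wordCode (v : List Bool) {k : ℕ} (hk : 0 < k) :
    trNat (wordCode v k) = (v.map bitSymbol).flatMap digits ++ trNat k := by
  induction v with
  | nil => rfl
  | cons b v ih =>
    have hpos := wordCode_pos v hk
    have h : wordCode (b :: v) k = 2 * (2 * wordCode v k) + b.toNat := by
      simp only [wordCode, List.foldr_cons]; ring
    cases b
    · rw [h, Bool.toNat_false, add_zero, trNat_two_mul (by omega), trNat_two_mul hpos, ih]
      rfl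
    · rw [h, Bool.toNat_true, trNat_two_mul_add_one, trNat_two_mul hpos, ih]
      rfl

theorem trNat_wordsCode (ws : List (List Bool)) :
    trNat (wordsCode ws) = (ws.flatMap fun v => v.map bitSymbol ++ [.consₗ]).flatMap digits := by
  induction ws with
  | nil => exact trNat_zero
  | cons v ws ih =>
    have h : wordsCode (v :: ws) = wordCode v (2 * (2 * wordsCode ws + 1)) := by
      simp only [wordsCode, List.foldr_cons]; congr 1; ring
    rw [h, trNat_wordCode v (by omega), trNat_two_mul (by omega), trNat_two_mul_add_one, ih]
    simp [digits, lowDigit, highDigit]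

theorem trNat_outCode (v : List Bool) : trNat (outCode v) = v.map bitSymbol ++ [.bit1] := by
  have hpos : ∀ v, 0 < outCode v := fun v => by
    induction v with
    | nil => exact one_pos
    | cons b v ih => simp only [outCode, List.foldr_cons] at ih ⊢; omega
  induction v with
  | nil => exact trNat_one
  | cons b v ih =>
    have h : outCode (b :: v) = 2 * outCode v + b.toNat := rfl
    cases b
    · rw [h, Bool.toNat_false, add_zero, trNat_two_mul (hpos v), ih]; rfl
    · rw [h, Bool.toNat_true, trNat_two_mul_add_one, ih]; rfl

theorem wordCode_inj {v v' : List Bool} {k k' : ℕ}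
    (h : wordCode v (4 * k + 2) = wordCode v' (4 * k' + 2)) : v = v' ∧ k = k' := by
  induction v generalizing v' with
  | nil =>
    cases v' with
    | nil => simp only [wordCode, List.foldr_nil] at h; exact ⟨rfl, by omega⟩
    | cons b v' =>
      simp only [wordCode, List.foldr_nil, List.foldr_cons] at h
      cases b <;> simp at h <;> omega
  | cons b v ih =>
    cases v' with
    | nil =>
      simp only [wordCode, List.foldr_nil, List.foldr_cons] at h
      cases b <;> simp at h <;> omega
    | cons b' v' =>
      simp only [wordCode, List.foldr_cons] at h ih
      have hb : b = b' := by cases b <;> cases b' <;> simp at h ⊢ <;> omega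
      subst hb
      obtain ⟨rfl, rfl⟩ := ih (v' := v') (by omega)
      exact ⟨rfl, rfl⟩

theorem wordsCode_injective : Function.Injective wordsCode := by
  intro ws ws' h
  have hpos : ∀ v ws, 0 < wordsCode (v :: ws) := fun v ws => wordCode_pos v (by omega)
  induction ws generalizing ws' with
  | nil =>
    cases ws' with
    | nil => rfl
    | cons v ws' => exact absurd h (hpos v ws').ne
  | cons v ws ih =>
    cases ws' with
    | nil => exact absurd h (hpos v ws).ne'
    | cons v' ws' =>
      obtain ⟨rfl, h'⟩ := wordCode_inj h
      rw [ih h']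

theorem primrec_wordsCode : Primrec wordsCode := by
  refine Primrec.list_foldr (h := fun _ (p : List Bool × ℕ) => wordCode p.1 (4 * p.2 + 2))
    Primrec.id (Primrec.const 0) ?_
  refine Primrec.list_foldr (h := fun _ (p : Bool × ℕ) => 4 * p.2 + p.1.toNat)
    (Primrec.fst.comp Primrec.snd) ?_ ?_
  · exact Primrec.nat_add.comp (Primrec.nat_mul.comp (Primrec.const 4)
      (Primrec.snd.comp Primrec.snd)) (Primrec.const 2)
  · exact Primrec.nat_add.comp (Primrec.nat_mul.comp (Primrec.const 4)
      (Primrec.snd.comp Primrec.snd)) ((Primrec.dom_bool Bool.toNat).comp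
        (Primrec.fst.comp Primrec.snd))

theorem primrec_outCode : Primrec outCode :=
  Primrec.list_foldr (h := fun _ (p : Bool × ℕ) => 2 * p.2 + p.1.toNat) Primrec.id
    (Primrec.const 1) (Primrec.nat_add.comp (Primrec.nat_double.comp
      (Primrec.snd.comp Primrec.snd)) ((Primrec.dom_bool Bool.toNat).comp
        (Primrec.fst.comp Primrec.snd)))

/-- A partial recursive function on tuples of words is evaluated, on codes, by a code for partial
recursive functions on lists of numbers. -/
theorem exists_code {n : ℕ} {F : (Fin n → List Bool) →. List Bool} (hF : Partrec F) :
    ∃ c : Code, ∀ w, c.eval [wordsCode (List.ofFn w)] = (F w).map fun v => [outCode v] := by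
  have hcode : Primrec fun w : Fin n → List Bool => wordsCode (List.ofFn w) :=
    primrec_wordsCode.comp
      ((Primrec.vector_toList.comp Primrec.vector_ofFn').of_eq fun w => by simp)
  -- the arguments are recovered from their code by unbounded search
  let find : ℕ → ℕ → Option (Fin n → List Bool) := fun m k =>
    (@Encodable.decode _ Primcodable.toEncodable k : Option (Fin n → List Bool)).bind fun w =>
      if wordsCode (List.ofFn w) = m then some w else none
  have hfind : Primrec₂ find := by
    refine Primrec.option_bind (Primrec.decode.comp Primrec.snd) (Primrec.ite ?_ ?_ ?_)
    · exact Primrec.eq.comp (hcode.comp Primrec.snd) (Primrec.fst.comp Primrec.fst)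
    · exact Primrec.option_some.comp Primrec.snd
    · exact Primrec.const none
  have hG : Partrec fun m => ((Nat.rfindOpt (find m)).bind F).map outCode :=
    ((Partrec.rfindOpt hfind.to_comp).bind (hF.comp Computable.snd).to₂).map
      (primrec_outCode.to_comp.comp Computable.snd).to₂
  obtain ⟨c, hc⟩ := Code.exists_code (Nat.Partrec'.part_iff₁.2 hG)
  refine ⟨c, fun w => ?_⟩
  have hw : Nat.rfindOpt (find (wordsCode (List.ofFn w))) = Part.some w := by
    have hspec : ∀ w', w' ∈ Nat.rfindOpt (find (wordsCode (List.ofFn w))) → w' = w := by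
      intro w' h
      obtain ⟨k, hk⟩ := Nat.rfindOpt_spec h
      obtain ⟨w'', -, h2⟩ := Option.bind_eq_some_iff.1 hk
      split at h2
      · rename_i h3
        cases h2
        exact List.ofFn_injective (wordsCode_injective h3)
      · cases h2
    have hdom : (Nat.rfindOpt (find (wordsCode (List.ofFn w)))).Dom :=
      Nat.rfindOpt_dom.2 ⟨@Encodable.encode _ Primcodable.toEncodable w, w, by simp [find]⟩
    have hmem := Part.get_mem hdom
    rw [hspec _ hmem] at hmem
    exact Part.eq_some_iff.2 hmem
  have := hc (wordsCode (List.ofFn w) ::ᵥ List.Vector.nil)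
  simp only [List.Vector.head_cons, hw] at this
  refine this.trans ?_
  show ((Part.some w).bind F |>.map outCode).map pure = _
  rw [show (Part.some w).bind F = F w from Part.bind_some w F, Part.map_map]
  rfl

/-! ### Partial recursive functions are Turing-computable -/

instance : Fintype K' := ⟨{.main, .rev, .aux, .stack}, fun k => by cases k <;> simp⟩

/-- The tape symbol that represents a symbol on the stack `aux`. -/
def tapeSymbol (s : Γ') : TM2to1.Γ' K' (fun _ => Γ') :=
  (false, Function.update (fun _ => none) .aux (some s))

theorem tapeSymbol_injective : Function.Injective tapeSymbol := fun s t h => by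
  simpa [tapeSymbol] using congrFun (congrArg Prod.snd h) K'.aux

theorem tapeSymbol_ne_default (s : Γ') : tapeSymbol s ≠ default := fun h => by
  have := congrFun (congrArg Prod.snd h) K'.aux
  simp [tapeSymbol, default] at this

theorem bitSymbol_injective : Function.Injective bitSymbol := by decide

theorem turingInput_eq {n : ℕ} (w : Fin n → List Bool) :
    TuringInput (fun b => tapeSymbol (bitSymbol b)) (tapeSymbol .consₗ) w =
      (TuringInput bitSymbol .consₗ w).map tapeSymbol := by
  simp [TuringInput, List.map_flatMap, Function.comp_def]

/-- The contents of the tape, without the bottom cell, when the stacks represented on it are empty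
except for `aux`. -/
theorem turingOutput_tail_addBottom {v : List Bool} {L : ListBlank (∀ _ : K', Option Γ')}
    (hL : ∀ k, L.map (proj k) = ListBlank.mk
      (((K'.elim [] [] ((v.map bitSymbol).reverse ++ [.consₗ]) [] k).map some).reverse)) :
    TuringOutput (fun b => tapeSymbol (bitSymbol b)) (TM2to1.addBottom L).tail v := by
  have hnth : ∀ i, (TM2to1.addBottom L).tail.nth i =
      (false, Function.update (fun _ => none) .aux ((v.map bitSymbol)[i]?)) := fun i => by
    rw [← ListBlank.nth_succ]
    refine Prod.ext (TM2to1.addBottom_nth_succ_fst L i) ?_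
    rw [TM2to1.addBottom_nth_snd]
    funext k
    rw [TM2to1.stk_nth_val (i + 1) (hL k)]
    cases k <;> simp [K'.elim]
  refine ⟨fun i => ?_, fun b => ?_⟩
  · rw [hnth]
    simp only [tapeSymbol, List.get_eq_getElem]
    simp
    rfl
  · rw [hnth]
    intro h
    have := congrFun (congrArg Prod.snd h) K'.aux
    simp [tapeSymbol] at this

theorem turingComputable_of_partrec {n : ℕ} {F : (Fin n → List Bool) →. List Bool}
    (hF : Partrec F) : TuringComputable F := by
  obtain ⟨c, hc⟩ := exists_code hF
  obtain ⟨T, hT⟩ := exists_supports c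
  let M := TM1to0.tr (TM2to1.tr (machine c))
  let S : Set (TM1to0.Λ' (TM2to1.tr (machine c))) :=
    ↑(TM1to0.trStmts (TM2to1.tr (machine c)) (TM2to1.trSupp (machine c) T))
  have hS : TM0.Supports M S := TM1to0.tr_supports _ (TM2to1.tr_supports (machine c) hT)
  have hfin : Finite S := Finset.finite_toSet _
  -- the first cell gets the mark that identifies the bottom of the stacks
  let f : TM2to1.Γ' K' (fun _ => Γ') → TM2to1.Γ' K' (fun _ => Γ') := fun a => (true, a.2)
  have hm : ∀ w : Fin n → List Bool, trNat (wordsCode (List.ofFn w)) =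
      (TuringInput bitSymbol .consₗ w).flatMap digits := fun w => trNat_wordsCode _
  have hinit : ∀ w : Fin n → List Bool,
      TM2to1.trInit .aux (TuringInput bitSymbol .consₗ w).reverse =
        (f (TuringInput (fun b => tapeSymbol (bitSymbol b)) (tapeSymbol .consₗ) w).headI ::
          (TuringInput (fun b => tapeSymbol (bitSymbol b)) (tapeSymbol .consₗ) w).tail) :=
    fun w => by
      rw [turingInput_eq]
      simp only [TM2to1.trInit, List.reverse_reverse]
      rfl
  refine ⟨TM2to1.Γ' K' (fun _ => Γ'), TM0.FrameState S, inferInstance,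
    inferInstanceAs (Finite (Bool × (K' → Option Γ'))), inferInstance, inferInstance,
    TM0.frame M S f, fun b => tapeSymbol (bitSymbol b), tapeSymbol .consₗ, fun _ _ h => bitSymbol_injective (tapeSymbol_injective h),
    fun b h => ?_, fun b => tapeSymbol_ne_default _, tapeSymbol_ne_default _, fun w v hv => ?_,
    fun w hw => ?_⟩
  · have := tapeSymbol_injective h
    cases b <;> cases this
  · have hmem : [outCode v] ∈ c.eval [wordsCode (List.ofFn w)] := by
      rw [hc]; exact Part.mem_map _ hv
    obtain ⟨x, hx⟩ := mem_eval c _ (hm w) (trNat_outCode v)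
      (by simp [bitSymbol]) hmem
    obtain ⟨_, ⟨L, hL⟩, hx'⟩ := tr_eval (TM2to1.tr_respects (machine c))
      (TM2to1.trCfg_init .aux _) hx
    refine ⟨(TM2to1.addBottom L).tail, TM0.mem_eval_frame hS ?_, turingOutput_tail_addBottom hL⟩
    rw [← hinit, TM1to0.tr_eval]
    exact (Part.mem_map_iff _).2 ⟨_, hx', by simp⟩
  · refine TM0.not_dom_eval_frame hS ?_
    rw [← hinit, TM1to0.tr_eval]
    show ¬ (eval _ _).Dom
    rw [tr_eval_dom (TM2to1.tr_respects (machine c)) (TM2to1.trCfg_init .aux _)]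
    refine not_dom_eval c _ (hm w) ?_
    rw [hc]
    exact hw

end Turing.StackIO

/-! ### Programs built from straight-line code and loops -/

namespace RAM

open PGA StateTransition

theorem bton_ntob (n : ℕ) : bton (ntob n) = n := by
  induction n using Nat.strong_induction_on with
  | _ n ih =>
    rw [ntob]
    split
    · rcases (by omega : n = 0 ∨ n = 1) with rfl | rfl <;> rfl
    · rw [bton, ih (n / 2) (by omega)]
      rcases Nat.mod_two_eq_zero_or_one n with h | h <;> simp [h] <;> omega

/-- The number represented by the contents of a register. -/
def MState.val (σ : MState) (r : ℕ) : ℕ := bton (σ.1 r)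

theorem bton_val_dir (σ : MState) (r : ℕ) : bton ((Src.dir r).val σ) = σ.val r := rfl

theorem bton_val_imm (σ : MState) (x : ℕ) : bton ((Src.imm x).val σ) = x := bton_ntob x

/-- A basic command: an instruction, or an instruction that is only performed if register `r`
contains the number `x`. -/
inductive Cmd
  | plain (a : BInstr)
  | guard (r x : ℕ) (a : BInstr)

namespace Cmd

/-- The instruction that is possibly performed. -/
def instr : Cmd → BInstr
  | plain a => a
  | guard _ _ a => a

/-- The instruction sequence for a command. If the test of a guard succeeds, the jump after it leads
to the instruction, otherwise that jump is skipped and the next one leads past the instruction. -/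
def code : Cmd → List (PInstr BInstr)
  | plain a => [.plain a]
  | guard r x a => [.pos (cmpInstr .eq (.dir r) (.imm x)), .jmp 2, .jmp 2, .plain a]

/-- The effect of a command. -/
def exec : Cmd → MState → MState
  | plain a, σ => a.q σ
  | guard r x a, σ => if σ.val r = x then a.q σ else σ

theorem isCode {c : Cmd} (h : IsCode [.plain c.instr]) : IsCode c.code := by
  cases c with
  | plain a => exact h
  | guard r x a => exact (IsCode.cmp _ _ _ _).append ((IsCode.jmp 2).append h)

end Cmd

/-- The instruction sequence for a list of commands. -/
def blockCode (b : List Cmd) : List (PInstr BInstr) := b.flatMap Cmd.code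

/-- The effect of a list of commands. -/
def exec (b : List Cmd) (σ : MState) : MState := b.foldl (fun σ c => c.exec σ) σ

@[simp] theorem exec_nil (σ : MState) : exec [] σ = σ := rfl

@[simp] theorem exec_cons (c : Cmd) (b : List Cmd) (σ : MState) :
    exec (c :: b) σ = exec b (c.exec σ) := rfl

theorem exec_append (b b' : List Cmd) (σ : MState) : exec (b ++ b') σ = exec b' (exec b σ) :=
  List.foldl_append

/-- The parts of a program: straight-line code, and loops that are repeated as long as register `r`
does not contain the number `0`. -/
inductive Seg
  | block (b : List Cmd)
  | loop (r : ℕ) (b : List Cmd)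

namespace Seg

/-- The commands that occur in a part of a program. -/
def cmds : Seg → List Cmd
  | block b => b
  | loop _ b => b

/-- The instruction sequence for a part of a program of length `N`. A backward jump over `k`
positions is a forward jump over `N - k` positions because the program is repeated. -/
def code (N : ℕ) : Seg → List (PInstr BInstr)
  | block b => blockCode b
  | loop r b => [.pos (cmpInstr .gt (.dir r) (.imm 0)), .jmp 2, .jmp ((blockCode b).length + 2)] ++
      (blockCode b ++ [.jmp (N - ((blockCode b).length + 3))])

/-- `Run s σ σ'`: the part `s` of a program transforms `σ` into `σ'`. -/
inductive Run : Seg → MState → MState → Prop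
  | block (b : List Cmd) (σ : MState) : Run (block b) σ (exec b σ)
  | done (r : ℕ) (b : List Cmd) (σ : MState) : σ.val r = 0 → Run (loop r b) σ σ
  | more (r : ℕ) (b : List Cmd) (σ σ' : MState) :
      σ.val r ≠ 0 → Run (loop r b) (exec b σ) σ' → Run (loop r b) σ σ'

theorem code_length (N N' : ℕ) (s : Seg) : (s.code N).length = (s.code N').length := by
  cases s <;> simp [code]

end Seg

/-- The sequential composition of `Seg.Run`. -/
inductive RunAll : List Seg → MState → MState → Prop
  | nil (σ : MState) : RunAll [] σ σ
  | cons {s : Seg} {l : List Seg} {σ₁ σ₂ σ₃ : MState} :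
      s.Run σ₁ σ₂ → RunAll l σ₂ σ₃ → RunAll (s :: l) σ₁ σ₃

theorem RunAll.append {k l : List Seg} {σ₁ σ₂ σ₃ : MState} (h : RunAll k σ₁ σ₂)
    (h' : RunAll l σ₂ σ₃) : RunAll (k ++ l) σ₁ σ₃ := by
  induction h with
  | nil => exact h'
  | cons hs _ ih => exact .cons hs (ih h')

/-- The instruction sequence for the parts of a program of length `N`. -/
def segsCode (N : ℕ) (l : List Seg) : List (PInstr BInstr) := l.flatMap (Seg.code N)

theorem segsCode_length (N N' : ℕ) (l : List Seg) :
    (segsCode N l).length = (segsCode N' l).length := by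
  induction l with
  | nil => rfl
  | cons s l ih =>
    simp only [segsCode, List.flatMap_cons, List.length_append] at ih ⊢
    rw [ih, s.code_length N N']

section Flow

variable {s : Term BInstr} {l : List (PInstr BInstr)}

theorem step_rep (h : Represents s l) {k : ℕ} {u : PInstr BInstr} {c : List (PInstr BInstr)}
    (hk : u :: c <+: l.drop k) (q : ℕ) (σ : MState) :
    step (.rep s) (q * l.length + k, σ) = next u (q * l.length + k) σ := by
  obtain ⟨r, hr⟩ := hk
  have hu : l[k]? = some u := by
    rw [← List.head?_drop, ← hr]; rfl
  have hlt : k < l.length := (List.getElem?_eq_some_iff.1 hu).1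
  refine step_of_get ?_ σ
  rw [h.get_rep, Nat.mul_add_mod', Nat.mod_eq_of_lt hlt, hu]

theorem prefix_drop_of_append {a b : List (PInstr BInstr)} {k : ℕ} (h : a ++ b <+: l.drop k) :
    a <+: l.drop k ∧ b <+: l.drop (k + a.length) := by
  obtain ⟨r, hr⟩ := h
  refine ⟨⟨b ++ r, by rw [← hr, List.append_assoc]⟩, r, ?_⟩
  rw [← List.drop_drop, ← hr, List.append_assoc, List.drop_left]

theorem prefix_drop_of_cons {u : PInstr BInstr} {b : List (PInstr BInstr)} {k : ℕ}
    (h : u :: b <+: l.drop k) : b <+: l.drop (k + 1) :=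
  (prefix_drop_of_append (a := [u]) h).2

theorem Cmd.reaches (h : Represents s l) {k : ℕ} {c : Cmd} (hk : c.code <+: l.drop k) (q : ℕ)
    (σ : MState) : Reaches (step (.rep s)) (q * l.length + k, σ)
      (q * l.length + (k + c.code.length), c.exec σ) := by
  cases c with
  | plain a => exact .single (step_rep h hk q σ)
  | guard r x a =>
    have h1 := prefix_drop_of_cons hk
    have h2 := prefix_drop_of_cons h1
    have h3 := prefix_drop_of_cons h2
    have hs := step_rep h hk q σ
    simp only [next, cmpInstr, CmpOp.eval, bton_val_dir, bton_val_imm, decide_eq_true_eq] at hs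
    by_cases hx : σ.val r = x
    · rw [if_pos hx] at hs
      have hs1 := step_rep h h1 q σ
      have hs3 := step_rep h h3 q σ
      refine .head hs (.head hs1 (.head hs3 ?_))
      simp only [Cmd.exec, if_pos hx]
      exact .refl
    · rw [if_neg hx] at hs
      have hs2 := step_rep h h2 q σ
      refine .head hs (.head hs2 ?_)
      simp only [Cmd.exec, if_neg hx]
      exact .refl

theorem reaches_block (h : Represents s l) {b : List Cmd} {k : ℕ}
    (hk : blockCode b <+: l.drop k) (q : ℕ) (σ : MState) :
    Reaches (step (.rep s)) (q * l.length + k, σ)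
      (q * l.length + (k + (blockCode b).length), exec b σ) := by
  induction b generalizing k σ with
  | nil => exact .refl
  | cons c b ih =>
    obtain ⟨h1, h2⟩ := prefix_drop_of_append (b := blockCode b) hk
    refine (c.reaches h h1 q σ).trans ?_
    have := ih h2 (c.exec σ)
    rwa [add_assoc, ← List.length_append] at this

/-- One iteration of a loop. -/
theorem reaches_iteration (h : Represents s l) {r : ℕ} {b : List Cmd} {k : ℕ}
    (hk : (Seg.loop r b).code l.length <+: l.drop k) (q : ℕ) {σ : MState} (hσ : σ.val r ≠ 0) :
    Reaches₁ (step (.rep s)) (q * l.length + k, σ) ((q + 1) * l.length + k, exec b σ) := by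
  have h1 := prefix_drop_of_cons hk
  obtain ⟨h3, h4⟩ :=
    prefix_drop_of_append (a := blockCode b) (prefix_drop_of_cons (prefix_drop_of_cons h1))
  have hs := step_rep h hk q σ
  simp only [next, cmpInstr, CmpOp.eval, bton_val_dir, bton_val_imm, decide_eq_true_eq] at hs
  rw [if_pos (Nat.pos_of_ne_zero hσ)] at hs
  refine Relation.TransGen.head' hs (Reaches.head (step_rep h h1 q σ) ?_)
  refine (reaches_block h h3 q σ).tail ?_
  rw [Option.mem_def, step_rep h h4]
  have hlen : (blockCode b).length + 4 ≤ l.length := by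
    have := hk.length_le
    simp [Seg.code] at this
    omega
  have : (q + 1) * l.length = q * l.length + l.length := by ring
  simp only [next, Option.some.injEq, Prod.mk.injEq, and_true]
  omega

theorem Seg.Run.reaches (h : Represents s l) {g : Seg} {k : ℕ} {σ σ' : MState}
    (hg : g.Run σ σ') (hk : g.code l.length <+: l.drop k) (q : ℕ) :
    ∃ q', Reaches (step (.rep s)) (q * l.length + k, σ)
      (q' * l.length + (k + (g.code l.length).length), σ') := by
  induction hg generalizing q with
  | block b σ => exact ⟨q, reaches_block h hk q σ⟩
  | done r b σ hσ =>
    refine ⟨q, ?_⟩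
    have h1 := prefix_drop_of_cons hk
    have h2 := prefix_drop_of_cons h1
    have hs := step_rep h hk q σ
    simp only [next, cmpInstr, CmpOp.eval, bton_val_dir, bton_val_imm, decide_eq_true_eq] at hs
    rw [if_neg (by simpa using hσ)] at hs
    refine .head hs (.head (step_rep h h2 q σ) ?_)
    have : (q * l.length + (k + 1 + 1) + ((blockCode b).length + 2)) =
      q * l.length + (k + ((Seg.loop r b).code l.length).length) := by simp [Seg.code]; omega
    rw [this]
    exact .refl
  | more r b σ σ' hσ _ ih =>
    obtain ⟨q', hq'⟩ := ih hk (q + 1)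
    exact ⟨q', (reaches_iteration h hk q hσ).to_reflTransGen.trans hq'⟩

theorem RunAll.reaches (h : Represents s l) {gs : List Seg} {k : ℕ} {σ σ' : MState}
    (hg : RunAll gs σ σ') (hk : segsCode l.length gs <+: l.drop k) (q : ℕ) :
    ∃ q', Reaches (step (.rep s)) (q * l.length + k, σ)
      (q' * l.length + (k + (segsCode l.length gs).length), σ') := by
  induction hg generalizing k q with
  | nil σ => exact ⟨q, .refl⟩
  | @cons g gs σ₁ σ₂ σ₃ hr _ ih =>
    obtain ⟨h1, h2⟩ := prefix_drop_of_append (b := segsCode l.length gs) hk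
    obtain ⟨q₁, hq₁⟩ := hr.reaches h h1 q
    obtain ⟨q₂, hq₂⟩ := ih h2 q₁
    refine ⟨q₂, hq₁.trans ?_⟩
    rwa [add_assoc, ← List.length_append] at hq₂

end Flow

/-- The parts of a program can be put together to a semi-realistic RAM program that behaves
accordingly: it halts if all parts can be run, and does not halt if a loop is reached in a state
with a property that guarantees another iteration and is preserved by the iterations. -/
theorem exists_program (gs : List Seg) (hgs : ∀ g ∈ gs, ∀ c ∈ g.cmds, IsCode [.plain c.instr]) :
    ∃ P, IsSRRAMProgram P ∧
      (∀ σ σ', RunAll gs σ σ' → ∃ j, (j, σ') ∈ eval (step P) (0, σ)) ∧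
      (∀ (pre post : List Seg) (r : ℕ) (b : List Cmd), gs = pre ++ .loop r b :: post →
        ∀ I : MState → Prop, (∀ σ, I σ → σ.val r ≠ 0 ∧ I (exec b σ)) →
          ∀ σ σ', RunAll pre σ σ' → I σ' → ¬ (eval (step P) (0, σ)).Dom) := by
  let N := (segsCode 0 gs).length + 1
  let l := segsCode N gs ++ [.halt]
  have hN : l.length = N := by simp [l, N, segsCode_length N 0]
  have hblock : ∀ b : List Cmd, (∀ c ∈ b, IsCode [.plain c.instr]) → IsCode (blockCode b) := by
    intro b hb
    induction b with
    | nil => exact .nil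
    | cons c b ih =>
      exact (Cmd.isCode (hb c List.mem_cons_self)).append
        (ih fun c hc => hb c (List.mem_cons_of_mem _ hc))
  have hcode : IsCode (segsCode N gs) := by
    clear_value N
    clear l hN
    induction gs with
    | nil => exact .nil
    | cons g gs ih =>
      refine IsCode.append ?_ (ih fun g hg => hgs g (List.mem_cons_of_mem _ hg))
      have hb := hblock g.cmds (hgs g List.mem_cons_self)
      cases g with
      | block b => exact hb
      | loop r b =>
        exact ((IsCode.cmp _ _ _ 2).append (IsCode.jmp _)).append (hb.append (IsCode.jmp _))
  obtain ⟨s, hs, hrep⟩ := (hcode.append .halt).exists_isBody (l := l) (by simp [l])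
  refine ⟨.rep s, ⟨s, hs, rfl⟩, fun σ σ' h => ?_, fun pre post r b hpre I hI σ σ' h hσ' => ?_⟩
  · obtain ⟨q, hq⟩ := h.reaches hrep (k := 0) ⟨[.halt], by rw [hN]; rfl⟩ 0
    rw [Nat.zero_mul, zero_add] at hq
    refine ⟨_, mem_eval.2 ⟨hq, ?_⟩⟩
    have hhalt : [.halt] <+: l.drop (segsCode l.length gs).length := by
      rw [hN]
      simp [l]
    rw [zero_add]
    exact step_rep hrep hhalt q σ'
  · have hpost :
        segsCode N pre ++ (Seg.code N (.loop r b) ++ (segsCode N post ++ [.halt])) = l := by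
      simp [l, hpre, segsCode]
    obtain ⟨q, hq⟩ := h.reaches hrep (k := 0) ⟨_, by rw [hN, hpost]; rfl⟩ 0
    rw [Nat.zero_mul] at hq
    rw [reaches_eval hq]
    refine not_dom_of_progress (S := fun c => ∃ q σ, c = (q * l.length +
      (0 + (segsCode l.length pre).length), σ) ∧ I σ) ?_ ⟨q, σ', rfl, hσ'⟩
    rintro _ ⟨q, σ, rfl, hσ⟩
    obtain ⟨h1, h2⟩ := hI σ hσ
    refine ⟨_, ⟨q + 1, _, rfl, h2⟩, reaches_iteration hrep ?_ q h1⟩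
    rw [hN, zero_add]
    conv_rhs => rw [← hpost, List.drop_left]
    exact List.prefix_append _ _

end RAM

/-! ### Arithmetic with named registers -/

namespace RAM

open PGA StateTransition

/-- Names for the working registers of the simulation of a Turing machine. -/
inductive Reg
  | cnt | word | pow | tmp | dig | left | head | right | state | run | act | idx | tape | out
  deriving DecidableEq

/-- The number of a working register: the working registers follow the `n` input registers. -/
def Reg.num (n : ℕ) : Reg → ℕ
  | cnt => n + 1
  | word => n + 2
  | pow => n + 3
  | tmp => n + 4
  | dig => n + 5
  | left => n + 6
  | head => n + 7
  | right => n + 8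
  | state => n + 9
  | run => n + 10
  | act => n + 11
  | idx => n + 12
  | tape => n + 13
  | out => n + 14

theorem Reg.num_inj {n : ℕ} {a b : Reg} : a.num n = b.num n ↔ a = b := by
  cases a <;> cases b <;> simp [num]

theorem Reg.lt_num (n : ℕ) (a : Reg) : n < a.num n := by
  cases a <;> simp [num]

/-- The number in a working register. -/
def MState.reg (n : ℕ) (σ : MState) (a : Reg) : ℕ := σ.val (a.num n)

/-- The source operand for a working register. -/
def src (n : ℕ) (a : Reg) : Src := .dir (a.num n)

@[simp] theorem bton_val_src (n : ℕ) (σ : MState) (a : Reg) :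
    bton ((src n a).val σ) = σ.reg n a := rfl

attribute [simp] bton_val_imm

/-- A binary operation with a working register as destination. -/
def op (n : ℕ) (o : BinOp) (s₁ s₂ : Src) (d : Reg) : Cmd :=
  .plain (binInstr o s₁ s₂ (.dir (d.num n)))

/-- A binary operation with a working register as destination that is performed only if the
register `g` contains the number `x`. -/
def opIf (n : ℕ) (g : Reg) (x : ℕ) (o : BinOp) (s₁ s₂ : Src) (d : Reg) : Cmd :=
  .guard (g.num n) x (binInstr o s₁ s₂ (.dir (d.num n)))

@[simp] theorem bton_eval_add (u v : List Bool) : bton (BinOp.add.eval u v) = bton u + bton v :=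
  bton_ntob _

@[simp] theorem bton_eval_sub (u v : List Bool) : bton (BinOp.sub.eval u v) = bton u - bton v :=
  bton_ntob _

@[simp] theorem bton_eval_mul (u v : List Bool) : bton (BinOp.mul.eval u v) = bton u * bton v :=
  bton_ntob _

@[simp] theorem bton_eval_div (u v : List Bool) : bton (BinOp.div.eval u v) = bton u / bton v :=
  bton_ntob _

theorem MState.reg_set (n : ℕ) (σ : MState) (d : Reg) (w : List Bool) (a : Reg) :
    (σ.set (d.num n) w).reg n a = if a = d then bton w else σ.reg n a := by
  unfold reg val
  rw [set_apply]
  simp only [Reg.num_inj]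
  split <;> rfl

@[simp] theorem reg_exec_op (n : ℕ) (o : BinOp) (s₁ s₂ : Src) (d : Reg) (σ : MState) (a : Reg) :
    ((op n o s₁ s₂ d).exec σ).reg n a =
      if a = d then bton (o.eval (s₁.val σ) (s₂.val σ)) else σ.reg n a :=
  σ.reg_set n d _ a

@[simp] theorem reg_exec_opIf (n : ℕ) (g : Reg) (x : ℕ) (o : BinOp) (s₁ s₂ : Src) (d : Reg)
    (σ : MState) (a : Reg) : ((opIf n g x o s₁ s₂ d).exec σ).reg n a =
      if σ.reg n g = x ∧ a = d then bton (o.eval (s₁.val σ) (s₂.val σ)) else σ.reg n a := by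
  have h : (opIf n g x o s₁ s₂ d).exec σ =
    if σ.reg n g = x then σ.set (d.num n) (o.eval (s₁.val σ) (s₂.val σ)) else σ := rfl
  rw [h]
  by_cases hx : σ.reg n g = x
  · simp [hx, σ.reg_set]
  · simp [hx]

/-- The commands that consist of an instruction with a working register as destination. -/
def IsWork (n : ℕ) (c : Cmd) : Prop :=
  (∃ o s₁ s₂ d, c.instr = binInstr o s₁ s₂ (.dir (Reg.num n d))) ∨
    ∃ o s d, c.instr = unInstr o s (.dir (Reg.num n d))

theorem IsWork.op (n : ℕ) (o : BinOp) (s₁ s₂ : Src) (d : Reg) : IsWork n (op n o s₁ s₂ d) :=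
  .inl ⟨o, s₁, s₂, d, rfl⟩

theorem IsWork.opIf (n : ℕ) (g : Reg) (x : ℕ) (o : BinOp) (s₁ s₂ : Src) (d : Reg) :
    IsWork n (opIf n g x o s₁ s₂ d) :=
  .inl ⟨o, s₁, s₂, d, rfl⟩

theorem IsWork.isCode {n : ℕ} {c : Cmd} (h : IsWork n c) : IsCode [.plain c.instr] := by
  rcases h with ⟨o, s₁, s₂, d, h⟩ | ⟨o, s, d, h⟩
  · rw [h]; exact .bin _ _ _ _
  · rw [h]; exact .un _ _ _

/-- Commands on working registers leave the input registers unchanged. -/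
theorem IsWork.exec_apply {n : ℕ} {c : Cmd} (h : IsWork n c) (σ : MState) {k : ℕ} (hk : k ≤ n) :
    (c.exec σ).1 k = σ.1 k := by
  have hq : (c.instr.q σ).1 k = σ.1 k := by
    rcases h with ⟨o, s₁, s₂, d, h⟩ | ⟨o, s, d, h⟩
    all_goals
      rw [h]
      refine (MState.set_apply _ _ _ _).trans (if_neg ?_)
      have := d.lt_num n
      simp only [Dst.reg]
      omega
  cases c with
  | plain a => exact hq
  | guard r x a =>
    simp only [Cmd.exec]
    split
    · exact hq
    · rfl

theorem exec_apply_of_isWork {n : ℕ} {b : List Cmd} (h : ∀ c ∈ b, IsWork n c) (σ : MState) {k : ℕ}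
    (hk : k ≤ n) : (exec b σ).1 k = σ.1 k := by
  induction b generalizing σ with
  | nil => rfl
  | cons c b ih =>
    rw [exec_cons, ih fun c hc => h c (List.mem_cons_of_mem _ hc)]
    exact (h c List.mem_cons_self).exec_apply σ hk

/-- A table: `d` gets the value `f x`, where `x < m` is the number in register `g`. -/
def lookup (n : ℕ) (g d : Reg) (f : ℕ → ℕ) (m : ℕ) : List Cmd :=
  (List.range m).map fun x => opIf n g x .add (.imm (f x)) (.imm 0) d

theorem isWork_lookup (n : ℕ) (g d : Reg) (f : ℕ → ℕ) (m : ℕ) :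
    ∀ c ∈ lookup n g d f m, IsWork n c := by
  intro c hc
  obtain ⟨x, -, rfl⟩ := List.mem_map.1 hc
  exact .opIf _ _ _ _ _ _ _

theorem reg_exec_lookup (n : ℕ) {g d : Reg} (hgd : g ≠ d) (f : ℕ → ℕ) (m : ℕ) (σ : MState)
    (a : Reg) : (exec (lookup n g d f m) σ).reg n a =
      if σ.reg n g < m ∧ a = d then f (σ.reg n g) else σ.reg n a := by
  induction m generalizing a with
  | zero => simp [lookup]
  | succ m ih =>
    have h : lookup n g d f (m + 1) =
        lookup n g d f m ++ [opIf n g m .add (.imm (f m)) (.imm 0) d] := by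
      simp [lookup, List.range_succ]
    rw [h, exec_append, exec_cons, exec_nil, reg_exec_opIf, ih, ih]
    rcases lt_trichotomy (σ.reg n g) m with hm | hm | hm
    · simp [hgd, hm.ne, hm, hm.trans (Nat.lt_succ_self m)]
    · by_cases ha : a = d <;> simp [hgd, hm, ha]
    · have h1 : ¬ σ.reg n g < m := by omega
      have h2 : ¬ σ.reg n g < m + 1 := by omega
      simp [hgd, hm.ne', h1, h2]

/-! ### Translation of the input -/

theorem bton_map_not_add (w : List Bool) : bton (w.map Bool.not) + bton w = 2 ^ w.length - 1 := by
  induction w with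
  | nil => rfl
  | cons b w ih =>
    have := Nat.one_le_two_pow (n := w.length)
    rw [List.map_cons, bton, bton, List.length_cons, pow_succ]
    cases b <;> simp <;> omega

/-- The loop that adds the symbols for the bits of a word, as digits with base `B`, to the number in
register `right`. The number `2 ^ l - 1`, where `l` is the length of what remains of the word,
controls the loop. -/
def wordLoop (n B : ℕ) (f : ℕ → ℕ) : List Cmd :=
  [op n .div (src n .word) (.imm 2) .tmp,
    op n .mul (src n .tmp) (.imm 2) .dig,
    op n .sub (src n .word) (src n .dig) .dig,
    op n .add (src n .tmp) (.imm 0) .word,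
    op n .div (src n .cnt) (.imm 2) .cnt] ++
  lookup n .dig .tmp f 2 ++
  [op n .mul (src n .tmp) (src n .pow) .tmp,
    op n .add (src n .right) (src n .tmp) .right,
    op n .mul (src n .pow) (.imm B) .pow]

/-- The code that prepares the translation of the word in register `k`. -/
def wordInit (n k : ℕ) : List Cmd :=
  [.plain (unInstr .not (.dir k) (.dir (Reg.num n .cnt))),
    op n .add (src n .cnt) (.dir k) .cnt,
    op n .add (.dir k) (.imm 0) .word]

/-- The code that adds the digit `x` to the number in register `right`. -/
def addDigit (n B x : ℕ) : List Cmd :=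
  [op n .mul (.imm x) (src n .pow) .tmp,
    op n .add (src n .right) (src n .tmp) .right,
    op n .mul (src n .pow) (.imm B) .pow]

/-- The part of the program that translates the words in the registers `k + 1, …, k + m`. -/
def inputSegs (n B : ℕ) (f : ℕ → ℕ) (x : ℕ) : ℕ → ℕ → List Seg
  | _, 0 => []
  | k, m + 1 => .block (wordInit n (k + 1)) :: .loop (Reg.num n .cnt) (wordLoop n B f) ::
      .block (addDigit n B x) :: inputSegs n B f x (k + 1) m

theorem isWork_wordLoop (n B : ℕ) (f : ℕ → ℕ) : ∀ c ∈ wordLoop n B f, IsWork n c := by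
  simp only [wordLoop, List.mem_append, List.mem_cons, List.not_mem_nil, or_false]
  rintro c (((rfl | rfl | rfl | rfl | rfl) | h) | rfl | rfl | rfl)
  all_goals first | exact .op _ _ _ _ _ | exact isWork_lookup _ _ _ _ _ c h

theorem isWork_wordInit (n k : ℕ) : ∀ c ∈ wordInit n k, IsWork n c := by
  simp only [wordInit, List.mem_cons, List.not_mem_nil, or_false]
  rintro c (rfl | rfl | rfl)
  · exact .inr ⟨_, _, _, rfl⟩
  · exact .op _ _ _ _ _
  · exact .op _ _ _ _ _

theorem isWork_addDigit (n B x : ℕ) : ∀ c ∈ addDigit n B x, IsWork n c := by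
  simp only [addDigit, List.mem_cons, List.not_mem_nil, or_false]
  rintro c (rfl | rfl | rfl) <;> exact .op _ _ _ _ _

theorem run_wordLoop (n B : ℕ) (f : ℕ → ℕ) (v : List Bool) (σ : MState)
    (hw : σ.reg n .word = bton v) (hc : σ.reg n .cnt = 2 ^ v.length - 1) :
    ∃ σ', Seg.Run (.loop (Reg.num n .cnt) (wordLoop n B f)) σ σ' ∧
      (∀ k ≤ n, σ'.1 k = σ.1 k) ∧
      σ'.reg n .right =
        σ.reg n .right + σ.reg n .pow * Nat.ofDigits B (v.map fun b => f b.toNat) ∧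
      σ'.reg n .pow = σ.reg n .pow * B ^ v.length := by
  induction v generalizing σ with
  | nil => exact ⟨σ, .done _ _ _ hc, fun _ _ => rfl, by simp, by simp⟩
  | cons b v ih =>
    have h2 := Nat.one_le_two_pow (n := v.length)
    have hb : b.toNat < 2 := Bool.toNat_lt b
    rw [bton] at hw
    rw [List.length_cons, pow_succ] at hc
    have hd : σ.reg n .word / 2 = bton v := by omega
    have hm : σ.reg n .word - bton v * 2 = b.toNat := by omega
    have hc' : σ.reg n .cnt / 2 = 2 ^ v.length - 1 := by omega
    have hreg : ∀ a, (exec (wordLoop n B f) σ).reg n a = match a with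
        | .word => bton v
        | .cnt => 2 ^ v.length - 1
        | .right => σ.reg n .right + f b.toNat * σ.reg n .pow
        | .pow => σ.reg n .pow * B
        | .tmp => f b.toNat * σ.reg n .pow
        | .dig => b.toNat
        | a => σ.reg n a := by
      intro a
      cases a <;> simp [wordLoop, exec_append,
        reg_exec_lookup n (show Reg.dig ≠ Reg.tmp by decide), hd, hm, hb, hc']
    obtain ⟨σ', h1, h3, h4, h5⟩ := ih (exec (wordLoop n B f) σ) (hreg _) (hreg _)
    refine ⟨σ', .more _ _ _ _ (show σ.reg n .cnt ≠ 0 by omega) h1, fun k hk => ?_, ?_, ?_⟩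
    · rw [h3 k hk, exec_apply_of_isWork (isWork_wordLoop n B f) σ hk]
    · rw [h4, hreg, hreg, List.map_cons, Nat.ofDigits_cons]
      push_cast
      ring
    · rw [h5, hreg, List.length_cons]
      ring

/-- The effect of the translation of words: the number in register `right` is extended by the digits
for the bits of the words and, at the end of each word, the digit `x`. -/
theorem run_inputSegs (n B : ℕ) (f : ℕ → ℕ) (x : ℕ) (ws : List (List Bool)) (k : ℕ) (σ : MState)
    (hk : k + ws.length ≤ n) (hσ : ∀ i (h : i < ws.length), σ.1 (k + 1 + i) = ws[i]) :
    ∃ σ', RunAll (inputSegs n B f x k ws.length) σ σ' ∧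
      σ'.reg n .right = σ.reg n .right + σ.reg n .pow *
        Nat.ofDigits B (ws.flatMap fun v => v.map (fun b => f b.toNat) ++ [x]) := by
  induction ws generalizing k σ with
  | nil => exact ⟨σ, .nil σ, by simp⟩
  | cons v ws ih =>
    rw [List.length_cons] at hk
    have hv : σ.1 (k + 1) = v := hσ 0 (by simp)
    have hinit : ∀ a, (exec (wordInit n (k + 1)) σ).reg n a = match a with
        | .cnt => 2 ^ v.length - 1
        | .word => bton v
        | a => σ.reg n a := by
      have h1 : ∀ a, (Cmd.exec (.plain (unInstr .not (.dir (k + 1)) (.dir (Reg.num n .cnt)))) σ).reg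
          n a = if a = .cnt then bton (v.map Bool.not) else σ.reg n a := by
        intro a
        exact (σ.reg_set n .cnt _ a).trans (by simp [UnOp.eval, Src.val, hv])
      have h2 : ∀ c, IsWork n c → (c.exec σ).1 (k + 1) = v := fun c hc => by
        rw [hc.exec_apply σ (by omega), hv]
      have h3 : (Cmd.exec (.plain (unInstr .not (.dir (k + 1)) (.dir (Reg.num n .cnt)))) σ).val
          (k + 1) = bton v := congrArg bton (h2 _ (.inr ⟨_, _, _, rfl⟩))
      have h4 : ((op n .add (src n .cnt) (.dir (k + 1)) .cnt).exec
          (Cmd.exec (.plain (unInstr .not (.dir (k + 1)) (.dir (Reg.num n .cnt)))) σ)).val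
          (k + 1) = bton v := by
        unfold MState.val
        rw [(IsWork.op _ _ _ _ _).exec_apply _ (by omega)]
        exact h3
      intro a
      rw [wordInit, exec_cons, exec_cons, exec_cons, exec_nil]
      cases a <;> simp [h1, h3, h4, bton_val_dir, bton_map_not_add]
    obtain ⟨σ₁, hr, h1, h2, h3⟩ := run_wordLoop n B f v _ (hinit .word) (hinit .cnt)
    simp only [hinit] at h2 h3
    have hdig : ∀ a, (exec (addDigit n B x) σ₁).reg n a = match a with
        | .right => σ₁.reg n .right + x * σ₁.reg n .pow
        | .pow => σ₁.reg n .pow * B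
        | .tmp => x * σ₁.reg n .pow
        | a => σ₁.reg n a := by
      intro a
      cases a <;> simp [addDigit]
    obtain ⟨σ', hr', h4⟩ := ih (k + 1) (exec (addDigit n B x) σ₁) (by omega) fun i hi => by
      rw [exec_apply_of_isWork (isWork_addDigit n B x) _ (by omega), h1 _ (by omega),
        exec_apply_of_isWork (isWork_wordInit n _) _ (by omega)]
      have := hσ (i + 1) (by simpa using hi)
      rwa [List.getElem_cons_succ, ← add_assoc, add_right_comm] at this
    refine ⟨σ', .cons (.block _ _) (.cons hr (.cons (.block _ _) hr')), ?_⟩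
    rw [h4, hdig, hdig, h2, h3, List.flatMap_cons, Nat.ofDigits_append, Nat.ofDigits_append,
      Nat.ofDigits_singleton]
    simp only [List.length_append, List.length_map, List.length_singleton]
    ring

theorem isWork_inputSegs (n B : ℕ) (f : ℕ → ℕ) (x k m : ℕ) :
    ∀ g ∈ inputSegs n B f x k m, ∀ c ∈ g.cmds, IsWork n c := by
  induction m generalizing k with
  | zero => simp [inputSegs]
  | succ m ih =>
    simp only [inputSegs, List.mem_cons]
    rintro g (rfl | rfl | rfl | h)
    · exact isWork_wordInit n _
    · exact isWork_wordLoop n B f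
    · exact isWork_addDigit n B x
    · exact ih _ g h

end RAM

/-! ### Tapes as numbers -/

namespace RAM

open PGA StateTransition Turing

/-- A numbering of a finite type in which the default element has the number `0`. -/
structure Numbering (Γ : Type) [Inhabited Γ] where
  /-- the number of an element -/
  code : Γ → ℕ
  /-- a bound for the numbers -/
  base : ℕ
  injective : Function.Injective code
  code_lt : ∀ a, code a < base
  code_default : code default = 0

namespace Numbering

variable {Γ : Type} [Inhabited Γ]

theorem nonempty [Finite Γ] : Nonempty (Numbering Γ) := by
  obtain ⟨n, ⟨e⟩⟩ := Finite.exists_equiv_fin Γ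
  have : NeZero n := ⟨fun h => (h ▸ e default).elim0⟩
  let e' := e.trans (Equiv.swap (e default) 0)
  exact ⟨⟨fun a => e' a, n, Fin.val_injective.comp e'.injective, fun a => (e' a).2, by simp [e']⟩⟩

variable (e : Numbering Γ)

/-- The element with a given number. -/
noncomputable def decode : ℕ → Γ := Function.invFun e.code

@[simp] theorem decode_code (a : Γ) : e.decode (e.code a) = a :=
  Function.leftInverse_invFun e.injective a

theorem base_pos : 0 < e.base := (e.code_lt default).pos

/-- The number `x` represents the half-tape `L`: its digits are the numbers of the symbols, the
first symbol being the least significant one. -/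
def Codes (L : ListBlank Γ) (x : ℕ) : Prop := ∀ i, x / e.base ^ i % e.base = e.code (L.nth i)

variable {e}

theorem Codes.mod {L : ListBlank Γ} {x : ℕ} (h : e.Codes L x) : x % e.base = e.code L.head := by
  simpa using h 0

theorem Codes.tail {L : ListBlank Γ} {x : ℕ} (h : e.Codes L x) : e.Codes L.tail (x / e.base) := by
  intro i
  rw [Nat.div_div_eq_div_mul, ← pow_succ', h (i + 1), ListBlank.nth_succ]

theorem Codes.cons {L : ListBlank Γ} {x : ℕ} (h : e.Codes L x) (a : Γ) :
    e.Codes (L.cons a) (x * e.base + e.code a) := by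
  intro i
  cases i with
  | zero => simp [Nat.mod_eq_of_lt (e.code_lt a)]
  | succ i =>
    rw [pow_succ', ← Nat.div_div_eq_div_mul, add_comm, Nat.add_mul_div_right _ _ e.base_pos,
      Nat.div_eq_of_lt (e.code_lt a), zero_add, h i, ListBlank.nth_succ, ListBlank.tail_cons]

theorem codes_ofDigits (l : List Γ) :
    e.Codes (ListBlank.mk l) (Nat.ofDigits e.base (l.map e.code)) := by
  induction l with
  | nil => intro i; simp [ListBlank.nth_mk, e.code_default]
  | cons a l ih =>
    rw [← ListBlank.cons_mk, List.map_cons, Nat.ofDigits_cons, add_comm, mul_comm]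
    exact ih.cons a

end Numbering

/-! ### Simulation of a Turing machine -/

section Machine

variable {Γ Λ : Type} [Inhabited Γ] [Inhabited Λ] (M : TM0.Machine Γ Λ) (e : Numbering Γ)
  (d : Numbering Λ)

/-- The entry of the transition table of the machine for the state and the symbol whose numbers are
combined to the number `i`. -/
noncomputable def transition (i : ℕ) : Option (Λ × TM0.Stmt Γ) :=
  M (d.decode (i / e.base)) (e.decode (i % e.base))

/-- The number `1` if there is a next step, and `0` otherwise. -/
def runCode : Option (Λ × TM0.Stmt Γ) → ℕ
  | none => 0
  | some _ => 1

/-- The number of a kind of action: `0` for a move to the left, `1` for a move to the right, and `2`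
for all else. -/
def actCode : Option (Λ × TM0.Stmt Γ) → ℕ
  | some (_, .move .left) => 0
  | some (_, .move .right) => 1
  | _ => 2

/-- The number of the next state, where `x` is the number of the present one. -/
def stateCode (d : Numbering Λ) (x : ℕ) : Option (Λ × TM0.Stmt Γ) → ℕ
  | none => x
  | some (q, _) => d.code q

/-- The number of the symbol that takes the place of the symbol with number `x`. -/
def headCode (e : Numbering Γ) (x : ℕ) : Option (Λ × TM0.Stmt Γ) → ℕ
  | some (_, .write a) => e.code a
  | _ => x

/-- The code that combines the state and the symbol under the head to one number. -/
def fetch (n B : ℕ) : List Cmd :=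
  [op n .div (src n .right) (.imm B) .tmp,
    op n .mul (src n .tmp) (.imm B) .dig,
    op n .sub (src n .right) (src n .dig) .head,
    op n .mul (src n .state) (.imm B) .idx,
    op n .add (src n .idx) (src n .head) .idx]

/-- The code that looks up the next action. -/
noncomputable def tables (n : ℕ) : List Cmd :=
  lookup n .idx .run (fun i => runCode (transition M e d i)) (d.base * e.base) ++
  lookup n .idx .act (fun i => actCode (transition M e d i)) (d.base * e.base) ++
  lookup n .idx .state (fun i => stateCode d (i / e.base) (transition M e d i))
    (d.base * e.base) ++
  lookup n .idx .head (fun i => headCode e (i % e.base) (transition M e d i)) (d.base * e.base)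

/-- The code that performs an action on the tape. -/
def perform (n B : ℕ) : List Cmd :=
  [op n .add (src n .dig) (src n .head) .right,
    opIf n .act 1 .mul (src n .left) (.imm B) .left,
    opIf n .act 1 .add (src n .left) (src n .head) .left,
    opIf n .act 1 .add (src n .tmp) (.imm 0) .right,
    op n .div (src n .left) (.imm B) .tmp,
    op n .mul (src n .tmp) (.imm B) .dig,
    op n .sub (src n .left) (src n .dig) .dig,
    opIf n .act 0 .mul (src n .right) (.imm B) .right,
    opIf n .act 0 .add (src n .right) (src n .dig) .right,
    opIf n .act 0 .add (src n .tmp) (.imm 0) .left]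

/-- The code for one step of the machine. -/
noncomputable def machineStep (n : ℕ) : List Cmd :=
  fetch n e.base ++ tables M e d n ++ perform n e.base

theorem isWork_machineStep (n : ℕ) : ∀ c ∈ machineStep M e d n, IsWork n c := by
  simp only [machineStep, fetch, tables, perform, List.mem_append, List.mem_cons, List.not_mem_nil,
    or_false]
  rintro c (((rfl | rfl | rfl | rfl | rfl) | (((h | h) | h) | h)) |
    (rfl | rfl | rfl | rfl | rfl | rfl | rfl | rfl | rfl | rfl))
  all_goals first
    | exact .op _ _ _ _ _
    | exact .opIf _ _ _ _ _ _ _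
    | exact isWork_lookup _ _ _ _ _ c h

theorem reg_exec_fetch (n B : ℕ) (σ : MState) (a : Reg) :
    (exec (fetch n B) σ).reg n a = match a with
    | .tmp => σ.reg n .right / B
    | .dig => σ.reg n .right / B * B
    | .head => σ.reg n .right % B
    | .idx => σ.reg n .state * B + σ.reg n .right % B
    | a => σ.reg n a := by
  have h := Nat.mod_eq_sub_div_mul (x := σ.reg n .right) (k := B)
  cases a <;> simp [fetch, h]

theorem reg_exec_tables (n : ℕ) (σ : MState) (hσ : σ.reg n .idx < d.base * e.base) (a : Reg) :
    (exec (tables M e d n) σ).reg n a = match a with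
    | .run => runCode (transition M e d (σ.reg n .idx))
    | .act => actCode (transition M e d (σ.reg n .idx))
    | .state => stateCode d (σ.reg n .idx / e.base) (transition M e d (σ.reg n .idx))
    | .head => headCode e (σ.reg n .idx % e.base) (transition M e d (σ.reg n .idx))
    | a => σ.reg n a := by
  cases a <;> simp [tables, exec_append, reg_exec_lookup, hσ]

theorem reg_exec_perform (n B : ℕ) (σ : MState) :
    (exec (perform n B) σ).reg n .run = σ.reg n .run ∧
    (exec (perform n B) σ).reg n .state = σ.reg n .state ∧
    (exec (perform n B) σ).reg n .left = (match σ.reg n .act with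
      | 0 => σ.reg n .left / B
      | 1 => σ.reg n .left * B + σ.reg n .head
      | _ => σ.reg n .left) ∧
    (exec (perform n B) σ).reg n .right = (match σ.reg n .act with
      | 0 => (σ.reg n .dig + σ.reg n .head) * B + σ.reg n .left % B
      | 1 => σ.reg n .tmp
      | _ => σ.reg n .dig + σ.reg n .head) := by
  have h := Nat.mod_eq_sub_div_mul (x := σ.reg n .left) (k := B)
  refine ⟨by simp [perform], by simp [perform], ?_, ?_⟩
  all_goals
    rcases hx : σ.reg n .act with _ | _ | x <;> simp [perform, hx, h]

/-- The working registers represent a configuration of the machine. -/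
def CfgRep (n : ℕ) (σ : MState) (c : TM0.Cfg Γ Λ) : Prop :=
  σ.reg n .state = d.code c.q ∧ e.Codes c.Tape.left (σ.reg n .left) ∧
    e.Codes c.Tape.right₀ (σ.reg n .right)

variable {e d}

theorem machineStep_spec {n : ℕ} {σ : MState} {c : TM0.Cfg Γ Λ} (h : CfgRep e d n σ c) :
    (∀ c', TM0.step M c = some c' → CfgRep e d n (exec (machineStep M e d n) σ) c' ∧
      (exec (machineStep M e d n) σ).reg n .run = 1) ∧
    (TM0.step M c = none → CfgRep e d n (exec (machineStep M e d n) σ) c ∧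
      (exec (machineStep M e d n) σ).reg n .run = 0) := by
  obtain ⟨q, T⟩ := c
  obtain ⟨hq, hl, hr⟩ := h
  obtain ⟨L, R, rfl⟩ := T.exists_mk'
  simp only [Tape.mk'_left, Tape.mk'_right₀] at hq hl hr
  have hlt : d.code q * e.base + e.code R.head < d.base * e.base := by
    have h1 := d.code_lt q
    have h2 := e.code_lt R.head
    nlinarith
  have hdiv : (d.code q * e.base + e.code R.head) / e.base = d.code q := by
    rw [add_comm, Nat.add_mul_div_right _ _ e.base_pos, Nat.div_eq_of_lt (e.code_lt _), zero_add]
  have hmod : (d.code q * e.base + e.code R.head) % e.base = e.code R.head := by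
    rw [add_comm, Nat.add_mul_mod_self_right, Nat.mod_eq_of_lt (e.code_lt _)]
  have htr : transition M e d (d.code q * e.base + e.code R.head) = M q R.head := by
    rw [transition, hdiv, hmod, d.decode_code, e.decode_code]
  have hidx : (exec (fetch n e.base) σ).reg n .idx = d.code q * e.base + e.code R.head := by
    rw [reg_exec_fetch, hq, hr.mod]
  have htab := reg_exec_tables M e d n (exec (fetch n e.base) σ) (hidx ▸ hlt)
  rw [hidx, htr, hdiv, hmod] at htab
  obtain ⟨h1, h2, h3, h4⟩ := reg_exec_perform n e.base (exec (tables M e d n)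
    (exec (fetch n e.base) σ))
  rw [← exec_append, ← exec_append, ← List.append_assoc] at h1 h2 h3 h4
  change (exec (machineStep M e d n) σ).reg n _ = _ at h1 h2 h3 h4
  simp only [htab, reg_exec_fetch] at h1 h2 h3 h4
  simp only [TM0.step, CfgRep, h1, h2, h3, h4, Tape.mk'_head]
  rcases hM : M q R.head with _ | ⟨q', (_ | _) | a⟩
  · simp only [Option.map_none, runCode, stateCode, actCode, headCode, Tape.mk'_left,
      Tape.mk'_right₀]
    refine ⟨fun _ h => by simp at h, fun _ => ⟨⟨trivial, hl, ?_⟩, trivial⟩⟩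
    rw [← R.cons_head_tail]
    simpa using hr.tail.cons R.head
  · simp only [Option.map_some, runCode, stateCode, actCode, headCode, Option.some.injEq]
    refine ⟨?_, fun h => by simp at h⟩
    rintro _ rfl
    rw [Tape.move_left_mk', Tape.mk'_left, Tape.mk'_right₀]
    refine ⟨⟨rfl, hl.tail, ?_⟩, trivial⟩
    rw [hl.mod]
    refine Numbering.Codes.cons ?_ _
    conv_lhs => rw [← R.cons_head_tail]
    exact hr.tail.cons R.head
  · simp only [Option.map_some, runCode, stateCode, actCode, headCode, Option.some.injEq]
    refine ⟨?_, fun h => by simp at h⟩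
    rintro _ rfl
    rw [Tape.move_right_mk', Tape.mk'_left, Tape.mk'_right₀]
    exact ⟨⟨rfl, hl.cons R.head, hr.tail⟩, trivial⟩
  · simp only [Option.map_some, runCode, stateCode, actCode, headCode, Option.some.injEq]
    refine ⟨?_, fun h => by simp at h⟩
    rintro _ rfl
    have hw : (Tape.mk' L R).write a = Tape.mk' L (R.tail.cons a) := by
      conv_lhs => rw [← R.cons_head_tail, Tape.write_mk', ListBlank.tail_cons]
    rw [hw, Tape.mk'_left, Tape.mk'_right₀]
    exact ⟨⟨rfl, hl, hr.tail.cons a⟩, trivial⟩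

theorem run_machine {n : ℕ} {σ : MState} {c c' : TM0.Cfg Γ Λ} (h : CfgRep e d n σ c)
    (hrun : σ.reg n .run = 1) (hc : c' ∈ eval (TM0.step M) c) :
    ∃ σ', Seg.Run (.loop (Reg.num n .run) (machineStep M e d n)) σ σ' ∧ CfgRep e d n σ' c' := by
  obtain ⟨hr, hhalt⟩ := mem_eval.1 hc
  clear hc
  have hne : ∀ {σ : MState}, σ.reg n .run = 1 → σ.val (Reg.num n .run) ≠ 0 := fun h => by
    change MState.reg n _ _ ≠ 0
    omega
  induction hr using Relation.ReflTransGen.head_induction_on generalizing σ with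
  | refl =>
    obtain ⟨h1, h2⟩ := (machineStep_spec M h).2 hhalt
    exact ⟨_, .more _ _ _ _ (hne hrun) (.done _ _ _ h2), h1⟩
  | head hstep _ ih =>
    obtain ⟨h1, h2⟩ := (machineStep_spec M h).1 _ hstep
    obtain ⟨σ', h3, h4⟩ := ih h1 h2
    exact ⟨σ', .more _ _ _ _ (hne hrun) h3, h4⟩

/-- A non-terminating run of the machine keeps the loop that simulates it running. -/
theorem machine_progress {n : ℕ} {σ : MState}
    (h : σ.reg n .run = 1 ∧ ∃ c : TM0.Cfg Γ Λ, CfgRep e d n σ c ∧ ¬ (eval (TM0.step M) c).Dom) :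
    σ.val (Reg.num n .run) ≠ 0 ∧ (exec (machineStep M e d n) σ).reg n .run = 1 ∧
      ∃ c : TM0.Cfg Γ Λ, CfgRep e d n (exec (machineStep M e d n) σ) c ∧
        ¬ (eval (TM0.step M) c).Dom := by
  obtain ⟨hrun, c, hc, hdom⟩ := h
  refine ⟨?_, ?_⟩
  · change MState.reg n _ _ ≠ 0
    omega
  · rcases hs : TM0.step M c with _ | c'
    · exact absurd (Part.dom_iff_mem.2 ⟨c, mem_eval.2 ⟨.refl, hs⟩⟩) hdom
    · obtain ⟨h1, h2⟩ := (machineStep_spec M hc).1 _ hs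
      exact ⟨h2, c', h1, by rwa [← reaches_eval (.single hs)]⟩

end Machine

end RAM

/-! ### Extraction of the output -/

namespace RAM

open PGA StateTransition Turing

theorem ntob_bton_add_two_pow (v : List Bool) : ntob (bton v + 2 ^ v.length) = v ++ [true] := by
  induction v with
  | nil => rw [ntob]; rfl
  | cons b v ih =>
    have h := Nat.one_le_two_pow (n := v.length)
    have hb := Bool.toNat_lt b
    rw [ntob, bton, List.length_cons, pow_succ, if_neg (by omega)]
    have h1 : (2 * bton v + b.toNat + 2 ^ v.length * 2) / 2 = bton v + 2 ^ v.length := by omega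
    have h2 : (2 * bton v + b.toNat + 2 ^ v.length * 2) % 2 = b.toNat := by omega
    rw [h1, h2, ih]
    cases b <;> rfl

theorem shr_rol_append_true (v : List Bool) : shr (rol (v ++ [true])) = v := by
  obtain ⟨b, w, h⟩ := List.exists_cons_of_ne_nil (l := v ++ [true]) (by simp)
  rw [h, rol, shr, ← h, List.dropLast_concat]

section Output

variable {Γ : Type} [Inhabited Γ] (e : Numbering Γ) (bit : Bool → Γ)

open Classical in
/-- The number `1` if the symbol with number `x` is a bit, and `0` otherwise. -/
noncomputable def isBit (x : ℕ) : ℕ := if ∃ b, x = e.code (bit b) then 1 else 0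

open Classical in
/-- The value of the bit with number `x`. -/
noncomputable def bitValue (x : ℕ) : ℕ := if x = e.code (bit true) then 1 else 0

/-- The code that gets the next symbol of the output and tests whether it is a bit. -/
noncomputable def outputTest (n : ℕ) : List Cmd :=
  [op n .div (src n .right) (.imm e.base) .tmp,
    op n .mul (src n .tmp) (.imm e.base) .dig,
    op n .sub (src n .right) (src n .dig) .dig] ++
  lookup n .dig .run (isBit e bit) e.base

/-- The code that initializes the extraction of the output. -/
noncomputable def outputInit (n : ℕ) : List Cmd :=
  [op n .add (.imm 0) (.imm 0) .out, op n .add (.imm 1) (.imm 0) .pow] ++ outputTest e bit n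

/-- The code that adds one bit to the number in register `out`. -/
noncomputable def outputLoop (n : ℕ) : List Cmd :=
  lookup n .dig .word (bitValue e bit) e.base ++
  [op n .mul (src n .word) (src n .pow) .word,
    op n .add (src n .out) (src n .word) .out,
    op n .mul (src n .pow) (.imm 2) .pow,
    op n .add (src n .tmp) (.imm 0) .right] ++ outputTest e bit n

/-- The code that turns the number of the output into a bit string, with its leading zeros. The
number obtained by adding a bit `1` at the most significant end is represented by a unique shortest
bit string; a rotation and a shift remove that bit. -/
def outputFinish (n : ℕ) : List Cmd :=
  [op n .add (src n .out) (src n .pow) .out,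
    .plain (unInstr .rol (src n .out) (.dir 0)),
    .plain (unInstr .shr (.dir 0) (.dir 0))]

theorem isWork_outputTest (n : ℕ) : ∀ c ∈ outputTest e bit n, IsWork n c := by
  simp only [outputTest, List.mem_append, List.mem_cons, List.not_mem_nil, or_false]
  rintro c ((rfl | rfl | rfl) | h)
  all_goals first | exact .op _ _ _ _ _ | exact isWork_lookup _ _ _ _ _ c h

theorem isWork_outputInit (n : ℕ) : ∀ c ∈ outputInit e bit n, IsWork n c := by
  simp only [outputInit, List.mem_append, List.mem_cons, List.not_mem_nil, or_false]
  rintro c ((rfl | rfl) | h)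
  all_goals first | exact .op _ _ _ _ _ | exact isWork_outputTest _ _ _ c h

theorem isWork_outputLoop (n : ℕ) : ∀ c ∈ outputLoop e bit n, IsWork n c := by
  simp only [outputLoop, List.mem_append, List.mem_cons, List.not_mem_nil, or_false]
  rintro c ((h | (rfl | rfl | rfl | rfl)) | h)
  all_goals first
    | exact .op _ _ _ _ _
    | exact isWork_outputTest _ _ _ c h
    | exact isWork_lookup _ _ _ _ _ c h

theorem isCode_outputFinish (n : ℕ) : ∀ c ∈ outputFinish n, IsCode [.plain c.instr] := by
  simp only [outputFinish, List.mem_cons, List.not_mem_nil, or_false]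
  rintro c (rfl | rfl | rfl)
  · exact (IsWork.op _ _ _ _ _).isCode
  · exact .un _ _ _
  · exact .un _ _ _

theorem reg_exec_outputTest (n : ℕ) (σ : MState) (a : Reg) :
    (exec (outputTest e bit n) σ).reg n a = match a with
    | .tmp => σ.reg n .right / e.base
    | .dig => σ.reg n .right % e.base
    | .run => isBit e bit (σ.reg n .right % e.base)
    | a => σ.reg n a := by
  have h := Nat.mod_eq_sub_div_mul (x := σ.reg n .right) (k := e.base)
  cases a <;> simp [outputTest, reg_exec_lookup, ← h, Nat.mod_lt _ e.base_pos]

theorem reg_exec_outputLoop (n : ℕ) (σ : MState) (hσ : σ.reg n .dig < e.base) :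
    (exec (outputLoop e bit n) σ).reg n .out =
      σ.reg n .out + bitValue e bit (σ.reg n .dig) * σ.reg n .pow ∧
    (exec (outputLoop e bit n) σ).reg n .pow = σ.reg n .pow * 2 ∧
    (exec (outputLoop e bit n) σ).reg n .right = σ.reg n .tmp ∧
    (exec (outputLoop e bit n) σ).reg n .tmp = σ.reg n .tmp / e.base ∧
    (exec (outputLoop e bit n) σ).reg n .dig = σ.reg n .tmp % e.base ∧
    (exec (outputLoop e bit n) σ).reg n .run = isBit e bit (σ.reg n .tmp % e.base) := by
  refine ⟨?_, ?_, ?_, ?_, ?_, ?_⟩ <;>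
    simp [outputLoop, exec_append, reg_exec_outputTest, reg_exec_lookup, hσ]

variable {e bit}

theorem isBit_code (b : Bool) : isBit e bit (e.code (bit b)) = 1 := if_pos ⟨b, rfl⟩

theorem isBit_code_of_ne {a : Γ} (h : ∀ b, a ≠ bit b) : isBit e bit (e.code a) = 0 :=
  if_neg fun ⟨b, hb⟩ => h b (e.injective hb)

theorem bitValue_code (hbit : Function.Injective bit) (b : Bool) :
    bitValue e bit (e.code (bit b)) = b.toNat := by
  cases b
  · exact if_neg fun h => by simpa using hbit (e.injective h)
  · exact if_pos rfl

theorem _root_.TuringOutput.of_cons {L : ListBlank Γ} {b : Bool} {v : List Bool}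
    (h : TuringOutput bit L (b :: v)) : L.head = bit b ∧ TuringOutput bit L.tail v := by
  obtain ⟨h1, h2⟩ := h
  refine ⟨by simpa using h1 ⟨0, by simp⟩, fun i => ?_, fun b => ?_⟩
  · have := h1 i.succ
    rwa [Fin.val_succ, ListBlank.nth_succ] at this
  · have := h2 b
    rwa [List.length_cons, ListBlank.nth_succ] at this

theorem run_outputLoop (hbit : Function.Injective bit) {n : ℕ} (v : List Bool) {σ : MState}
    {L : ListBlank Γ} (hL : TuringOutput bit L v) (htmp : e.Codes L.tail (σ.reg n .tmp))
    (hdig : σ.reg n .dig = e.code L.head)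
    (hrun : σ.reg n .run = isBit e bit (e.code L.head)) :
    ∃ σ', Seg.Run (.loop (Reg.num n .run) (outputLoop e bit n)) σ σ' ∧
      σ'.reg n .out = σ.reg n .out + σ.reg n .pow * bton v ∧
      σ'.reg n .pow = σ.reg n .pow * 2 ^ v.length := by
  induction v generalizing σ L with
  | nil =>
    rw [isBit_code_of_ne fun b => by simpa using hL.2 b] at hrun
    exact ⟨σ, .done _ _ _ hrun, by simp [bton], by simp⟩
  | cons b v ih =>
    obtain ⟨h1, h2⟩ := hL.of_cons
    rw [h1, isBit_code] at hrun
    obtain ⟨h3, h4, h5, h6, h7, h8⟩ :=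
      reg_exec_outputLoop e bit n σ (by rw [hdig]; exact e.code_lt _)
    obtain ⟨σ', hr, h9, h10⟩ := ih (σ := exec (outputLoop e bit n) σ) h2
      (by rw [h6]; exact htmp.tail) (by rw [h7, htmp.mod]) (by rw [h8, htmp.mod])
    refine ⟨σ', .more _ _ _ _ (by change MState.reg n _ _ ≠ 0; omega) hr, ?_, ?_⟩
    · rw [h9, h3, h4, hdig, h1, bitValue_code hbit, bton]
      ring
    · rw [h10, h4, List.length_cons]
      ring

/-- The extraction of the output from the tape. -/
theorem run_output (hbit : Function.Injective bit) {n : ℕ} {v : List Bool} {σ : MState}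
    {L : ListBlank Γ} (hL : TuringOutput bit L v) (hr : e.Codes L (σ.reg n .right)) :
    ∃ σ', RunAll [.block (outputInit e bit n), .loop (Reg.num n .run) (outputLoop e bit n),
      .block (outputFinish n)] σ σ' ∧ σ'.1 0 = v := by
  have hinit : ∀ a, (exec (outputInit e bit n) σ).reg n a = match a with
      | .out => 0
      | .pow => 1
      | .tmp => σ.reg n .right / e.base
      | .dig => σ.reg n .right % e.base
      | .run => isBit e bit (σ.reg n .right % e.base)
      | a => σ.reg n a := by
    intro a
    cases a <;> simp [outputInit, reg_exec_outputTest]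
  obtain ⟨σ', h1, h2, h3⟩ := run_outputLoop hbit v (σ := exec (outputInit e bit n) σ) hL
    (by rw [hinit]; exact hr.tail) (by rw [hinit]; exact hr.mod) (by rw [hinit]; simp only [hr.mod])
  simp only [hinit, zero_add, one_mul] at h2 h3
  refine ⟨_, .cons (.block _ _) (.cons h1 (.cons (.block _ _) (.nil _))), ?_⟩
  have hout : ((op n .add (src n .out) (src n .pow) .out).exec σ').1 (Reg.num n .out) =
      v ++ [true] := by
    refine (MState.set_apply _ _ _ _).trans ((if_pos rfl).trans ?_)
    simp only [BinOp.eval, bton_val_src, h2, h3, ntob_bton_add_two_pow]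
  rw [outputFinish, exec_cons, exec_cons, exec_cons, exec_nil]
  generalize (op n .add (src n .out) (src n .pow) .out).exec σ' = σ₁ at hout
  have hrol : (Cmd.exec (.plain (unInstr .rol (src n .out) (.dir 0))) σ₁).1 0 =
      rol (v ++ [true]) := by
    refine (MState.set_apply _ _ _ _).trans ((if_pos rfl).trans ?_)
    exact congrArg rol hout
  refine (MState.set_apply _ _ _ _).trans ((if_pos rfl).trans ?_)
  exact (congrArg shr hrol).trans (shr_rol_append_true v)

end Output

/-! ### From Turing machines to programs -/

/-- The code that completes the start configuration of a machine, once the tape is in register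
`right`. The start state and blank tape to the left have the number `0`. -/
def machineInit (n : ℕ) : List Cmd :=
  [op n .add (.imm 0) (.imm 0) .left,
    op n .add (.imm 0) (.imm 0) .state,
    op n .add (.imm 1) (.imm 0) .run]

theorem isWork_machineInit (n : ℕ) : ∀ c ∈ machineInit n, IsWork n c := by
  simp only [machineInit, List.mem_cons, List.not_mem_nil, or_false]
  rintro c (rfl | rfl | rfl) <;> exact .op _ _ _ _ _

/-- The part of the program that puts the start configuration of a machine into the working
registers. -/
noncomputable def inputPart {Γ : Type} [Inhabited Γ] (e : Numbering Γ) (bit : Bool → Γ) (sep : Γ)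
    (n : ℕ) : List Seg :=
  .block [op n .add (.imm 1) (.imm 0) .pow] ::
    (inputSegs n e.base (fun i => e.code (bit (i == 1))) (e.code sep) 0 n ++
      [.block (machineInit n)])

theorem isWork_inputPart {Γ : Type} [Inhabited Γ] (e : Numbering Γ) (bit : Bool → Γ) (sep : Γ)
    (n : ℕ) : ∀ g ∈ inputPart e bit sep n, ∀ c ∈ g.cmds, IsWork n c := by
  simp only [inputPart, List.mem_cons, List.mem_append, List.not_mem_nil, or_false]
  rintro g (rfl | h | rfl)
  · intro c hc
    rw [List.mem_singleton.1 hc]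
    exact .op _ _ _ _ _
  · exact isWork_inputSegs _ _ _ _ _ _ g h
  · exact isWork_machineInit n

theorem run_inputPart {Γ Λ : Type} [Inhabited Γ] [Inhabited Λ] (e : Numbering Γ) (d : Numbering Λ)
    (bit : Bool → Γ) (sep : Γ) {n : ℕ} (w : Fin n → List Bool) :
    ∃ σ, RunAll (inputPart e bit sep n) (MState.input w) σ ∧ σ.reg n .run = 1 ∧
      CfgRep e d n σ (TM0.init (TuringInput bit sep w)) := by
  have hpow : ∀ a, (exec [op n .add (.imm 1) (.imm 0) .pow] (MState.input w)).reg n a =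
      if a = .pow then 1 else 0 := by
    intro a
    have h : (MState.input w).reg n a = 0 :=
      congrArg bton (dif_neg fun h => absurd (a.lt_num n) (by omega))
    simp [h]
  obtain ⟨σ, h1, h2⟩ := run_inputSegs n e.base (fun i => e.code (bit (i == 1))) (e.code sep)
    (List.ofFn w) 0 (exec [op n .add (.imm 1) (.imm 0) .pow] (MState.input w)) (by simp)
    (fun i hi => by
      rw [List.length_ofFn] at hi
      rw [exec_cons, exec_nil, (IsWork.op _ _ _ _ _).exec_apply _ (by omega), List.getElem_ofFn]
      refine (dif_pos (by omega)).trans ?_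
      congr 2
      omega)
  rw [List.length_ofFn] at h1
  refine ⟨exec (machineInit n) σ, .cons (.block _ _) (h1.append (.cons (.block _ _) (.nil _))),
    by simp [machineInit], by simp [machineInit, TM0.init, d.code_default], ?_, ?_⟩
  · have hl : (exec (machineInit n) σ).reg n .left = 0 := by simp [machineInit]
    rw [hl]
    intro i
    simp [TM0.init, Tape.mk₁, Tape.mk₂, ListBlank.nth_mk, e.code_default]
  · have hr : (exec (machineInit n) σ).reg n .right = σ.reg n .right := by simp [machineInit]
    rw [hr, h2, hpow, hpow]
    have ht : (TM0.init (TuringInput bit sep w) : TM0.Cfg Γ Λ).Tape.right₀ =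
        ListBlank.mk (TuringInput bit sep w) := Tape.mk'_right₀ _ _
    have hb : ∀ b : Bool, (b.toNat == 1) = b := by decide
    rw [ht]
    convert Numbering.codes_ofDigits (e := e) (TuringInput bit sep w) using 1
    simp [TuringInput, List.map_flatMap, hb, Function.comp_def]

/-- Turing-computable functions are computable by semi-realistic RAM programs. -/
theorem exists_program_of_turingComputable {n : ℕ} {F : (Fin n → List Bool) →. List Bool}
    (hF : TuringComputable F) : ∃ P, IsSRRAMProgram P ∧ Computes P F := by
  obtain ⟨Γ, Λ, _, _, _, _, M, bit, sep, hbit, -, -, -, hdef, hundef⟩ := hF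
  obtain ⟨e⟩ := Numbering.nonempty (Γ := Γ)
  obtain ⟨d⟩ := Numbering.nonempty (Γ := Λ)
  obtain ⟨P, hP, hrun, hloop⟩ := exists_program (inputPart e bit sep n ++
    .loop (Reg.num n .run) (machineStep M e d n) ::
      [.block (outputInit e bit n), .loop (Reg.num n .run) (outputLoop e bit n),
        .block (outputFinish n)]) <| by
    simp only [List.mem_append, List.mem_cons, List.not_mem_nil, or_false]
    rintro g (h | rfl | rfl | rfl | rfl) c hc
    · exact (isWork_inputPart e bit sep n g h c hc).isCode
    · exact (isWork_machineStep M e d n c hc).isCode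
    · exact (isWork_outputInit e bit n c hc).isCode
    · exact (isWork_outputLoop e bit n c hc).isCode
    · exact isCode_outputFinish n c hc
  refine ⟨P, hP, computes_iff.2 ⟨fun w v hv => ?_, fun w hw => ?_⟩⟩
  · obtain ⟨L, hL, hout⟩ := hdef w v hv
    obtain ⟨c, hc, rfl⟩ := (Part.mem_map_iff _).1 hL
    obtain ⟨σ₁, h1, h2, h3⟩ := run_inputPart e d bit sep w
    obtain ⟨σ₂, h4, h5⟩ := run_machine M h3 h2 hc
    obtain ⟨σ₃, h6, h7⟩ := run_output hbit hout h5.2.2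
    obtain ⟨j, hj⟩ := hrun _ _ (h1.append (.cons h4 h6))
    exact ⟨_, hj, h7⟩
  · obtain ⟨σ₁, h1, h2, h3⟩ := run_inputPart e d bit sep w
    exact hloop _ _ _ _ rfl _ (fun σ hσ => machine_progress M hσ) _ _ h1 ⟨h2, _, h3, hundef w hw⟩

end RAM

theorem theorem1 {n : ℕ} (F : (Fin n → List Bool) →. List Bool) :
    (∃ P : PGA.Term RAM.BInstr, RAM.IsSRRAMProgram P ∧ RAM.Computes P F) ↔
      TuringComputable F :=
  ⟨fun ⟨_, hP, hF⟩ =>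
      Turing.StackIO.turingComputable_of_partrec (RAM.partrec_of_computes hP hF),
    RAM.exists_program_of_turingComputable⟩
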